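/- Let $q\ge 4$ be an integer, let $0<\epsilon\le \tfrac12$, and consider the typewriter channel with input and output alphabet $\mathbb{Z}_q$ and transition probabilities $W(y|x)=1-\epsilon$ if $y=x$, $W(y|x)=\epsilon$ if $y=x+1 \bmod q$, and $W(y|x)=0$ otherwise, used without memory. All logarithms are to base $2$. Let $\mathsf{P}_e(M,n)$ be the smallest possible average probability of error of codes with $M$ codewords of length $n$ (over all codes and decoders), and let $$E(R)=\limsup_{n\to\infty}\frac1n\log\frac{1}{\mathsf{P}_e(\lceil 2^{nR}\rceil,n)}\in[0,+\infty]$$ be the reliability function of the channel (with $\log\frac10=+\infty$). Put $\alpha_\epsilon=\sqrt{\epsilon(1-\epsilon)}$, let $h_2(x)=-x\log x-(1-x)\log(1-x)$ be the binary entropy function, and let $$\delta_{LP2}(R)=\min\; 2\,\frac{\alpha(1-\alpha)-\beta(1-\beta)}{1+2\sqrt{\beta(1-\beta)}}$$ be the second McEliece–Rodemich–Rumsey–Welch linear-programming bound for binary codes, where the minimum is over all $0\le\beta\le\alpha\le\tfrac12$ satisfying $1-h_2(\alpha)+h_2(\beta)\le R$. Then for every real $R>\log(q/2)$, $$E(R)\le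 \delta_{LP2}\bigl(R-\log(q/2)\bigr)\,\log\frac{1}{\alpha_\epsilon}.$$ -/

import Mathlib

namespace Typewriter

open Filter

noncomputable section

/-- Transition probabilities `W(y|x)` of the typewriter channel on `ℤ/qℤ` with crossover
probability `ε`: the input `x` is received as `x` with probability `1 - ε` and as `x + 1` with
probability `ε`. -/
def W (q : ℕ) (ε : ℝ) (x y : ZMod q) : ℝ :=
  if y = x then 1 - ε else if y = x + 1 then ε else 0

/-- The memoryless extension of the channel to words of length `n`. -/
def Wn (q : ℕ) (ε : ℝ) {n : ℕ} (x y : Fin n → ZMod q) : ℝ :=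
  ∏ i, W q ε (x i) (y i)

/-- Average probability of error of the code with codewords `c 0, …, c (M - 1)` of length `n`
when the decoder `dec` is used. -/
def avgError (q : ℕ) [NeZero q] (ε : ℝ) {M n : ℕ} (c : Fin M → Fin n → ZMod q)
    (dec : (Fin n → ZMod q) → Fin M) : ℝ :=
  (1 / (M : ℝ)) * ∑ m, ∑ y, if dec y = m then 0 else Wn q ε (c m) y

/-- `Pe(M, n)`: the smallest average probability of error of codes with `M` codewords of length
`n`, over all codes and all decoders (a minimum over a finite set, nonempty for `M ≥ 1`). -/
def minError (q : ℕ) [NeZero q] (ε : ℝ) (M n : ℕ) : ℝ :=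
  ⨅ p : (Fin M → Fin n → ZMod q) × ((Fin n → ZMod q) → Fin M), avgError q ε p.1 p.2

/-- For `M ≥ 1` the infimum in `minError` is a minimum. -/
theorem exists_avgError_eq_minError (q : ℕ) [NeZero q] (ε : ℝ) (M n : ℕ) (hM : 1 ≤ M) :
    ∃ (c : Fin M → Fin n → ZMod q) (dec : (Fin n → ZMod q) → Fin M),
      avgError q ε c dec = minError q ε M n := by
  have : Nonempty (Fin M) := ⟨⟨0, hM⟩⟩
  obtain ⟨p, hp⟩ := exists_eq_ciInf_of_finite
    (f := fun p : (Fin M → Fin n → ZMod q) × ((Fin n → ZMod q) → Fin M) =>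
      avgError q ε p.1 p.2)
  exact ⟨p.1, p.2, hp⟩

/-- `(1/n) log₂ (1/P)` as an extended real, equal to `+∞` when `P = 0`. -/
def exponent (P : ℝ) (n : ℕ) : EReal :=
  if P = 0 then ⊤ else (((1 / (n : ℝ)) * Real.logb 2 (1 / P) : ℝ) : EReal)

/-- The reliability function `E(R)`, with values in the extended reals. -/
def reliability (q : ℕ) [NeZero q] (ε R : ℝ) : EReal :=
  limsup (fun n : ℕ => exponent (minError q ε ⌈(2 : ℝ) ^ ((n : ℝ) * R)⌉₊ n) n) atTop

/-- The binary entropy function in bits. -/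
def h2 (x : ℝ) : ℝ := Real.binEntropy x / Real.log 2

/-- The pairs `(a, b)` with `0 ≤ b ≤ a ≤ 1/2` and `1 - h₂(a) + h₂(b) ≤ R`. -/
def lp2Region (R : ℝ) : Set (ℝ × ℝ) :=
  {p | 0 ≤ p.2 ∧ p.2 ≤ p.1 ∧ p.1 ≤ 1 / 2 ∧ 1 - h2 p.1 + h2 p.2 ≤ R}

/-- The function minimized in the second linear-programming bound. -/
def lp2Fun (p : ℝ × ℝ) : ℝ :=
  2 * (p.1 * (1 - p.1) - p.2 * (1 - p.2)) / (1 + 2 * √(p.2 * (1 - p.2)))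

/-- The second McEliece–Rodemich–Rumsey–Welch linear-programming bound on the relative minimum
distance of binary codes of rate `R`. -/
def deltaLP2 (R : ℝ) : ℝ := sInf (lp2Fun '' lp2Region R)

/-- For `R ≥ 0` the infimum in `deltaLP2` is a minimum. -/
theorem isLeast_deltaLP2 (R : ℝ) (hR : 0 ≤ R) :
    IsLeast (lp2Fun '' lp2Region R) (deltaLP2 R) := by
  have hc : Continuous h2 := Real.binEntropy_continuous.div_const _
  have hne : (lp2Region R).Nonempty := by
    refine ⟨(1 / 2, 0), le_refl _, by norm_num, le_refl _, ?_⟩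
    have hl : Real.log 2 ≠ 0 := (Real.log_pos one_lt_two).ne'
    have h1 : h2 (1 / 2) = 1 := by
      rw [h2, one_div, Real.binEntropy_two_inv, div_self hl]
    have h0 : h2 0 = 0 := by simp [h2]
    simp only [h1, h0]
    linarith
  have hcl : IsClosed (lp2Region R) := by
    refine (isClosed_le continuous_const continuous_snd).inter
      ((isClosed_le continuous_snd continuous_fst).inter
        ((isClosed_le continuous_fst continuous_const).inter ?_))
    exact isClosed_le ((continuous_const.sub (hc.comp continuous_fst)).add
      (hc.comp continuous_snd)) continuous_const
  have hcpt : IsCompact (lp2Region R) := by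
    refine IsCompact.of_isClosed_subset
      ((isCompact_Icc (a := (0 : ℝ)) (b := 1 / 2)).prod
        (isCompact_Icc (a := (0 : ℝ)) (b := 1 / 2))) hcl ?_
    rintro ⟨a, b⟩ ⟨h1, h2, h3, -⟩
    simp only at h1 h2 h3
    exact ⟨⟨h1.trans h2, h3⟩, ⟨h1, h2.trans h3⟩⟩
  have hf : Continuous lp2Fun := by
    unfold lp2Fun
    refine Continuous.div (by fun_prop) (by fun_prop) (fun p => ?_)
    have := Real.sqrt_nonneg (p.2 * (1 - p.2))
    linarith
  exact (hcpt.image hf).isLeast_sInf (hne.image _)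

/-- `α_ε = √(ε (1 - ε))`. -/
def alphaEps (ε : ℝ) : ℝ := √(ε * (1 - ε))

end

end Typewriter

/-!
Take the words over `{0, 1}` of weight `w` and translate them by a fixed word of `(ℤ/qℤ)ⁿ`. Any
output reachable from two words of one translate is equally likely under both, and two such words at
Johnson distance `j` are confused with probability at least of order `α_ε ^ (2 * j)`. A code with
small error probability therefore meets every translate in a constant-weight code of large minimum
distance, and averaging over the translates (Elias–Bassalygo) bounds its size by a bound for binary
constant-weight codes.

For the latter, Delsarte's method is applied on the Johnson space. If `K` and `(τ - dist) * K` are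
positive semidefinite kernels, then so is their entrywise product `(τ - dist) * K ^ 2`, which limits
the size of a code whose distances are at least `d > τ`. The kernels `K` are combinations of zonal
ones, given by Hahn polynomials in the distance. In their index these satisfy the three-term
recurrence of a birth-and-death chain whose rates are nearly constant on a window of bounded length,
so that a geometrically weighted sine on such a window makes all coefficients of `(τ - dist) * K`
nonnegative as soon as `τ` exceeds `n * lp2Fun (a, b) / 2` asymptotically.
-/

/-! ### Hahn polynomials -/

namespace Johnson

open Finset

/-- Coefficients of the Hahn polynomial of index `κ` in the basis `j ↦ j.choose l`. The index is
real, so that the recurrence in `κ` is a polynomial identity. -/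
noncomputable def hahnCoeff (n w : ℕ) (κ : ℝ) (l : ℕ) : ℝ :=
  ∏ i ∈ range l, ((i - κ) * (n + 1 - κ - i)) / ((w - i) * (n - w - i))

/-- The Hahn polynomial of index `κ`: for `κ = 0, …, w` these are the zonal spherical functions of
the Johnson space of `w`-subsets of an `n`-set, as functions of the Johnson distance, normalized to
be `1` at distance `0`. -/
noncomputable def hahn (n w : ℕ) (κ : ℝ) (j : ℕ) : ℝ :=
  ∑ l ∈ range (w + 1), hahnCoeff n w κ l * j.choose l

/-- The coefficient of `hahn (κ + 1)` in the three-term recurrence of the Hahn polynomials, which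
is that of a birth-and-death chain in `κ`. -/
noncomputable def birthRate (n w : ℕ) (κ : ℝ) : ℝ :=
  (w - κ) * (n - w - κ) * (n + 1 - κ) / ((n - 2 * κ) * (n + 1 - 2 * κ))

/-- The coefficient of `hahn (κ - 1)` in the three-term recurrence of the Hahn polynomials. -/
noncomputable def deathRate (n w : ℕ) (κ : ℝ) : ℝ :=
  κ * (n + 1 - w - κ) * (w + 1 - κ) / ((n + 2 - 2 * κ) * (n + 1 - 2 * κ))

/-- The radial part of the Laplacian of the Johnson graph: a `w`-subset at distance `j` from a fixed
one has `(w - j) * (n - w - j)` neighbours at distance `j + 1` and `j ^ 2` at distance `j - 1`. -/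
def radialLaplacian (n w : ℕ) (f : ℕ → ℝ) (j : ℕ) : ℝ :=
  (w - j) * (n - w - j) * (f (j + 1) - f j) + j ^ 2 * (f (j - 1) - f j)

section Hahn

variable {n w : ℕ}

theorem sub_mul_sub_ne_zero (h : 2 * w ≤ n) {l : ℕ} (hl : l < w) :
    ((w : ℝ) - l) * (n - w - l) ≠ 0 := by
  have h' : 2 * (w : ℝ) ≤ n := by exact_mod_cast h
  have hl' : (l : ℝ) < w := by exact_mod_cast hl
  exact (mul_pos (by linarith) (by linarith)).ne'

@[simp]
theorem hahnCoeff_zero (κ : ℝ) : hahnCoeff n w κ 0 = 1 := by simp [hahnCoeff]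

theorem hahnCoeff_succ_mul (h : 2 * w ≤ n) (κ : ℝ) {l : ℕ} (hl : l < w) :
    hahnCoeff n w κ (l + 1) * ((w - l) * (n - w - l)) =
      hahnCoeff n w κ l * ((l - κ) * (n + 1 - κ - l)) := by
  rw [hahnCoeff, prod_range_succ, hahnCoeff, mul_assoc,
    div_mul_cancel₀ _ (sub_mul_sub_ne_zero h hl)]

theorem hahnCoeff_eq_zero {k l : ℕ} (hkl : k < l) : hahnCoeff n w k l = 0 :=
  prod_eq_zero (mem_range.2 hkl) (by simp)

theorem hahnCoeff_add_one (h : 2 * w ≤ n) (κ : ℝ) {l : ℕ} (hl : l < w) :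
    hahnCoeff n w (κ + 1) (l + 1) * (n + 1 - κ) * ((w - l) * (n - w - l)) =
      -((κ + 1) * (n + 1 - κ - l) * (n - κ - l)) * hahnCoeff n w κ l := by
  have h1 := hahnCoeff_succ_mul h (κ + 1) hl
  induction l with
  | zero =>
    simp only [hahnCoeff_zero, Nat.cast_zero] at h1 ⊢
    linear_combination (n + 1 - κ) * h1
  | succ l ih =>
    have hl' : l < w := Nat.lt_of_succ_lt hl
    have ih := ih hl' (hahnCoeff_succ_mul h (κ + 1) hl')
    have h2 := hahnCoeff_succ_mul h κ hl'
    apply mul_right_cancel₀ (sub_mul_sub_ne_zero h hl')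
    push_cast at h1 ih ⊢
    linear_combination (n + 1 - κ) * ((w - l) * (n - w - l)) * h1 +
      (l - κ) * (n - 1 - κ - l) * ih + (κ + 1) * (n - κ - l) * (n - 1 - κ - l) * h2

theorem hahnCoeff_sub_one (h : 2 * w ≤ n) (κ : ℝ) {l : ℕ} (hl : l < w) :
    hahnCoeff n w (κ - 1) (l + 1) * κ * ((w - l) * (n - w - l)) =
      -((l - κ) * (l + 1 - κ) * (n + 2 - κ)) * hahnCoeff n w κ l := by
  have h1 := hahnCoeff_succ_mul h (κ - 1) hl
  induction l with
  | zero =>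
    simp only [hahnCoeff_zero, Nat.cast_zero] at h1 ⊢
    linear_combination κ * h1
  | succ l ih =>
    have hl' : l < w := Nat.lt_of_succ_lt hl
    have ih := ih hl' (hahnCoeff_succ_mul h (κ - 1) hl')
    have h2 := hahnCoeff_succ_mul h κ hl'
    apply mul_right_cancel₀ (sub_mul_sub_ne_zero h hl')
    push_cast at h1 ih ⊢
    linear_combination κ * ((w - l) * (n - w - l)) * h1 +
      (l + 2 - κ) * (n + 1 - κ - l) * ih + (l + 1 - κ) * (l + 2 - κ) * (n + 2 - κ) * h2

theorem hahnCoeff_three_term (h : 2 * w ≤ n) {κ : ℝ} (hκ : 2 * κ < n) {l : ℕ} (hl : l < w) :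
    -((l + 1) * (hahnCoeff n w κ (l + 1) + hahnCoeff n w κ l)) =
      birthRate n w κ * (hahnCoeff n w (κ + 1) (l + 1) - hahnCoeff n w κ (l + 1)) +
        deathRate n w κ * (hahnCoeff n w (κ - 1) (l + 1) - hahnCoeff n w κ (l + 1)) := by
  have e₀ : (n : ℝ) - 2 * κ ≠ 0 := by linarith
  have e₁ : (n : ℝ) + 1 - 2 * κ ≠ 0 := by linarith
  have e₂ : (n : ℝ) + 2 - 2 * κ ≠ 0 := by linarith
  have hbirth : birthRate n w κ * ((n - 2 * κ) * (n + 1 - 2 * κ)) =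
      (w - κ) * (n - w - κ) * (n + 1 - κ) := div_mul_cancel₀ _ (mul_ne_zero e₀ e₁)
  have hdeath : deathRate n w κ * ((n + 2 - 2 * κ) * (n + 1 - 2 * κ)) =
      κ * (n + 1 - w - κ) * (w + 1 - κ) := div_mul_cancel₀ _ (mul_ne_zero e₂ e₁)
  have hsucc := hahnCoeff_succ_mul h κ hl
  have hadd := hahnCoeff_add_one h κ hl
  have hsub := hahnCoeff_sub_one h κ hl
  apply mul_right_cancel₀ (sub_mul_sub_ne_zero h hl)
  apply mul_right_cancel₀ (mul_ne_zero (mul_ne_zero e₀ e₁) e₂)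
  generalize hahnCoeff n w (κ + 1) (l + 1) = cadd at *
  generalize hahnCoeff n w (κ - 1) (l + 1) = csub at *
  generalize hahnCoeff n w κ (l + 1) = csucc at *
  linear_combination
    -((n + 2 - 2 * κ) * ((w - l) * (n - w - l)) * (cadd - csucc)) * hbirth -
    (n - 2 * κ) * ((w - l) * (n - w - l)) * (csub - csucc) * hdeath -
    (w - κ) * (n - w - κ) * (n + 2 - 2 * κ) * hadd -
    (n + 1 - w - κ) * (w + 1 - κ) * (n - 2 * κ) * hsub +
    ((n + 2 - 2 * κ) * ((w - κ) * (n - w - κ) * (n + 1 - κ)) +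
      (n - 2 * κ) * (κ * (n + 1 - w - κ) * (w + 1 - κ)) -
      (n - 2 * κ) * (n + 1 - 2 * κ) * (n + 2 - 2 * κ) * (l + 1)) * hsucc

theorem hahn_zero_right (κ : ℝ) : hahn n w κ 0 = 1 := by
  simp [hahn, sum_range_succ']

theorem hahn_zero_left (j : ℕ) : hahn n w 0 j = 1 := by
  have hcoeff (l : ℕ) : hahnCoeff n w 0 (l + 1) = 0 := by
    exact_mod_cast hahnCoeff_eq_zero (n := n) (w := w) l.succ_pos
  simp [hahn, sum_range_succ', hcoeff]

theorem cast_mul_choose (j l : ℕ) :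
    (j : ℝ) * j.choose l = l * j.choose l + (l + 1) * j.choose (l + 1) := by
  rcases le_or_gt l j with hl | hl
  · have : (j.choose (l + 1) : ℝ) * (l + 1) = j.choose l * ((j : ℝ) - l) := by
      rw [← Nat.cast_sub hl]
      exact_mod_cast Nat.choose_succ_right_eq j l
    linear_combination -this
  · simp [Nat.choose_eq_zero_of_lt hl, Nat.choose_eq_zero_of_lt (Nat.lt_succ_of_lt hl)]

theorem cast_mul_sum_mul_choose (c : ℕ → ℝ) {j : ℕ} (hj : j ≤ w) :
    (j : ℝ) * ∑ l ∈ range (w + 1), c l * j.choose l =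
      ∑ l ∈ range w, (l + 1) * (c (l + 1) + c l) * j.choose (l + 1) := by
  have hsplit : (j : ℝ) * ∑ l ∈ range (w + 1), c l * j.choose l =
      ∑ l ∈ range (w + 1), c l * (l * j.choose l) +
        ∑ l ∈ range (w + 1), c l * ((l + 1) * j.choose (l + 1)) := by
    rw [mul_sum, ← sum_add_distrib]
    exact sum_congr rfl fun l _ => by linear_combination c l * cast_mul_choose j l
  rw [hsplit, sum_range_succ', sum_range_succ _ w,
    Nat.choose_eq_zero_of_lt (Nat.lt_succ_of_le hj)]
  simp only [Nat.cast_zero, zero_mul, mul_zero, add_zero, ← sum_add_distrib]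
  exact sum_congr rfl fun l _ => by push_cast; ring

theorem neg_mul_hahn (h : 2 * w ≤ n) {κ : ℝ} (hκ : 2 * κ < n) {j : ℕ} (hj : j ≤ w) :
    -(j * hahn n w κ j) = birthRate n w κ * (hahn n w (κ + 1) j - hahn n w κ j) +
      deathRate n w κ * (hahn n w (κ - 1) j - hahn n w κ j) := by
  have hdiff (κ' : ℝ) : hahn n w κ' j - hahn n w κ j =
      ∑ l ∈ range w, (hahnCoeff n w κ' (l + 1) - hahnCoeff n w κ (l + 1)) * j.choose (l + 1) := by
    simp only [hahn, sum_range_succ' _ w, hahnCoeff_zero, add_sub_add_right_eq_sub,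
      ← sum_sub_distrib, sub_mul]
  rw [hdiff, hdiff, hahn, cast_mul_sum_mul_choose _ hj, mul_sum, mul_sum, ← sum_add_distrib,
    ← sum_neg_distrib]
  refine sum_congr rfl fun l hl => ?_
  linear_combination (j.choose (l + 1) : ℝ) * hahnCoeff_three_term h hκ (mem_range.1 hl)

theorem cast_mul_choose_pred_sub (j l : ℕ) :
    (j : ℝ) * ((j - 1).choose (l + 1) - j.choose (l + 1)) = -(l + 1) * j.choose (l + 1) := by
  cases j with
  | zero => simp
  | succ j =>
    have hpascal : ((j + 1).choose (l + 1) : ℝ) = j.choose l + j.choose (l + 1) := by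
      exact_mod_cast Nat.choose_succ_succ j l
    have habsorb : ((j + 1 : ℕ) : ℝ) * j.choose l = (j + 1).choose (l + 1) * ((l + 1 : ℕ) : ℝ) := by
      exact_mod_cast Nat.add_one_mul_choose_eq j l
    rw [Nat.add_sub_cancel]
    push_cast at habsorb ⊢
    linear_combination (-((j : ℝ) + 1)) * hpascal - habsorb

theorem radialLaplacian_choose (n w j l : ℕ) :
    radialLaplacian n w (fun i => i.choose (l + 1)) j =
      -((l + 1) * (n - l)) * j.choose (l + 1) + (w - l) * (n - w - l) * j.choose l := by
  have hpascal : ((j + 1).choose (l + 1) : ℝ) = j.choose l + j.choose (l + 1) := by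
    exact_mod_cast Nat.choose_succ_succ j l
  have h1 := cast_mul_choose j l
  have h2 := cast_mul_choose j (l + 1)
  push_cast at h2
  rw [radialLaplacian, hpascal]
  linear_combination j * cast_mul_choose_pred_sub j l + (-(n : ℝ) + j + l) * h1

theorem radialLaplacian_hahn_eq_sum (κ : ℝ) (j : ℕ) :
    radialLaplacian n w (hahn n w κ) j = ∑ l ∈ range w, hahnCoeff n w κ (l + 1) *
      (-((l + 1) * (n - l)) * j.choose (l + 1) + (w - l) * (n - w - l) * j.choose l) := by
  simp only [← radialLaplacian_choose, radialLaplacian, hahn, sum_range_succ' _ w,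
    Nat.choose_zero_right, add_sub_add_right_eq_sub, ← sum_sub_distrib, mul_sum,
    ← sum_add_distrib]
  exact sum_congr rfl fun l _ => by ring

theorem radialLaplacian_hahn (h : 2 * w ≤ n) {k : ℕ} (hk : k ≤ w) (j : ℕ) :
    radialLaplacian n w (hahn n w k) j = -(k * (n + 1 - k)) * hahn n w k j := by
  have htop : ((w : ℝ) - k) * hahnCoeff n w k w = 0 := by
    rcases hk.eq_or_lt with rfl | hk
    · simp
    · rw [hahnCoeff_eq_zero hk, mul_zero]
  have hdiag : ∑ l ∈ range w, hahnCoeff n w k (l + 1) * (-((l + 1) * (n - l)) * j.choose (l + 1)) =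
      ∑ l ∈ range (w + 1), hahnCoeff n w k l * (-(l * (n + 1 - l)) * j.choose l) := by
    rw [sum_range_succ']
    simp only [Nat.cast_zero, zero_mul, neg_zero, mul_zero, add_zero]
    exact sum_congr rfl fun l _ => by push_cast; ring
  have hsub : ∑ l ∈ range w, hahnCoeff n w k (l + 1) * ((w - l) * (n - w - l) * j.choose l) =
      ∑ l ∈ range (w + 1), hahnCoeff n w k l * ((l - k) * (n + 1 - k - l) * j.choose l) := by
    rw [sum_range_succ]
    have hsum := sum_congr rfl fun l hl =>
      congrArg (· * (j.choose l : ℝ)) (hahnCoeff_succ_mul h k (mem_range.1 hl))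
    simp only [mul_assoc] at hsum ⊢
    rw [hsum]
    linear_combination -((n : ℝ) + 1 - k - w) * j.choose w * htop
  rw [radialLaplacian_hahn_eq_sum]
  simp only [mul_add, sum_add_distrib]
  rw [hdiag, hsub, ← sum_add_distrib, hahn, mul_sum]
  exact sum_congr rfl fun l _ => by ring

theorem eq_of_radialLaplacian_eq (h : 2 * w ≤ n) {μ : ℝ} {f g : ℕ → ℝ} (h0 : f 0 = g 0)
    (hf : ∀ j ≤ w, radialLaplacian n w f j = μ * f j)
    (hg : ∀ j ≤ w, radialLaplacian n w g j = μ * g j) :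
    ∀ j ≤ w, f j = g j := by
  intro j
  induction j using Nat.strong_induction_on with
  | _ j ih =>
    intro hj
    cases j with
    | zero => exact h0
    | succ j =>
      have ih₁ := ih j (by omega) (by omega)
      have ih₂ := ih (j - 1) (by omega) (by omega)
      have hfj := hf j (by omega)
      have hgj := hg j (by omega)
      apply mul_left_cancel₀ (sub_mul_sub_ne_zero h (l := j) (by omega))
      rw [radialLaplacian] at hfj hgj
      rw [← ih₁, ← ih₂] at hgj
      linear_combination hfj - hgj

end Hahn

end Johnson

/-! ### The Johnson space and its zonal kernels -/

namespace Johnson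

open Finset

/-- The Johnson space, whose points are the `w`-element subsets of `Fin n`. -/
abbrev Slice (n w : ℕ) := {x : Finset (Fin n) // #x = w}

variable {n w : ℕ}

theorem exists_perm_apply_eq {α γ : Type*} [Fintype α] [DecidableEq γ] {f g : α → γ}
    (h : ∀ c, #{a | f a = c} = #{a | g a = c}) : ∃ σ : Equiv.Perm α, ∀ a, g (σ a) = f a := by
  have key (c : γ) : Nonempty ({a // f a = c} ≃ {a // g a = c}) :=
    ⟨Fintype.equivOfCardEq (by rw [Fintype.card_subtype, Fintype.card_subtype, h c])⟩
  exact ⟨Equiv.ofFiberEquiv fun c => (key c).some, Equiv.ofFiberEquiv_map _⟩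

/-- The real-valued indicator function of a finite set, in which the effect of a transposition on
the Johnson distance is a polynomial. -/
def ind (s : Finset (Fin n)) (a : Fin n) : ℝ := if a ∈ s then 1 else 0

theorem sum_ind (s : Finset (Fin n)) : ∑ a, ind s a = #s := by simp [ind]

theorem ind_mul_ind (s t : Finset (Fin n)) (a : Fin n) : ind s a * ind t a = ind (s ∩ t) a := by
  by_cases hs : a ∈ s <;> by_cases ht : a ∈ t <;> simp [ind, hs, ht]

namespace Slice

theorem nonempty (h : 2 * w ≤ n) : Nonempty (Slice n w) := by
  obtain ⟨x, -, hx⟩ := exists_subset_card_eq (s := (univ : Finset (Fin n))) (n := w)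
    (by rw [card_univ, Fintype.card_fin]; omega)
  exact ⟨x, hx⟩

/-- The Johnson distance, which is half of the Hamming distance. -/
def dist (x y : Slice n w) : ℕ := #(x.1 \ y.1)

/-- The action of permutations on the Johnson space. -/
def act (σ : Equiv.Perm (Fin n)) (x : Slice n w) : Slice n w :=
  ⟨x.1.map σ.toEmbedding, by rw [card_map, x.2]⟩

/-- The Laplacian of the random transposition walk on the Johnson space. Every edge of the Johnson
graph is counted twice in the double sum. -/
def laplacian (u : Slice n w → ℝ) (x : Slice n w) : ℝ :=
  ∑ a, ∑ b, (u (act (Equiv.swap a b) x) - u x)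

theorem dist_add_card_inter (x y : Slice n w) : dist x y + #(x.1 ∩ y.1) = w := by
  rw [dist, card_sdiff_add_card_inter, x.2]

theorem dist_le (x y : Slice n w) : dist x y ≤ w :=
  (Nat.le_add_right _ _).trans_eq (dist_add_card_inter x y)

theorem dist_comm (x y : Slice n w) : dist x y = dist y x := by
  have hxy := dist_add_card_inter x y
  have hyx := dist_add_card_inter y x
  rw [inter_comm] at hyx
  omega

@[simp]
theorem dist_self (x : Slice n w) : dist x x = 0 := by simp [dist]

theorem exists_dist_eq (h : 2 * w ≤ n) {j : ℕ} (hj : j ≤ w) :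
    ∃ x y : Slice n w, dist x y = j := by
  obtain ⟨x, hx⟩ := nonempty h
  obtain ⟨s, hs, hsc⟩ := exists_subset_card_eq (s := x) (n := w - j) (by omega)
  obtain ⟨t, ht, htc⟩ := exists_subset_card_eq (s := xᶜ) (n := j)
    (by rw [card_compl, Fintype.card_fin]; omega)
  have hst : Disjoint s t :=
    disjoint_of_subset_left hs (disjoint_of_subset_right ht disjoint_compl_right)
  have hxt : Disjoint x t := disjoint_of_subset_right ht disjoint_compl_right
  refine ⟨⟨x, hx⟩, ⟨s ∪ t, by rw [card_union_of_disjoint hst]; omega⟩, ?_⟩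
  rw [dist, sdiff_union_distrib, sdiff_eq_self_of_disjoint hxt,
    inter_eq_left.2 (sdiff_subset (s := x) (t := s)), card_sdiff_of_subset hs]
  omega

theorem card_filter_mem_mem (x y : Slice n w) (c : Bool × Bool) :
    #{a | (decide (a ∈ x.1), decide (a ∈ y.1)) = c} =
      match c with
      | (true, true) => w - dist x y
      | (false, false) => n - w - dist x y
      | _ => dist x y := by
  have hinter := dist_add_card_inter x y
  have hunion := card_union_add_card_inter x.1 y.1
  have hcompl := card_compl_add_card (x.1 ∪ y.1)
  have heq (s : Finset (Fin n))
      (hs : ∀ a, (decide (a ∈ x.1), decide (a ∈ y.1)) = c ↔ a ∈ s) :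
      #{a | (decide (a ∈ x.1), decide (a ∈ y.1)) = c} = #s := by
    simp only [hs, filter_univ_mem]
  rw [x.2, y.2] at hunion
  rw [Fintype.card_fin] at hcompl
  obtain ⟨_ | _, _ | _⟩ := c
  · rw [heq (x.1 ∪ y.1)ᶜ (by simp)]
    dsimp only
    omega
  · rw [heq (y.1 \ x.1) (by simp [and_comm])]
    exact dist_comm y x
  · rw [heq (x.1 \ y.1) (by simp)]
    rfl
  · rw [heq (x.1 ∩ y.1) (by simp)]
    dsimp only
    omega

theorem exists_act_eq {x y x' y' : Slice n w} (h : dist x y = dist x' y') :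
    ∃ σ, act σ x = x' ∧ act σ y = y' := by
  obtain ⟨σ, hσ⟩ := exists_perm_apply_eq
    (f := fun a => (decide (a ∈ x.1), decide (a ∈ y.1)))
    (g := fun a => (decide (a ∈ x'.1), decide (a ∈ y'.1)))
    (fun c => by rw [card_filter_mem_mem, card_filter_mem_mem, h])
  simp only [Prod.mk.injEq, decide_eq_decide] at hσ
  refine ⟨σ, Subtype.ext ?_, Subtype.ext ?_⟩
  · ext a
    simp only [act, mem_map_equiv, ← (hσ _).1, Equiv.apply_symm_apply]
  · ext a
    simp only [act, mem_map_equiv, ← (hσ _).2, Equiv.apply_symm_apply]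

@[simp]
theorem dist_act (σ : Equiv.Perm (Fin n)) (x y : Slice n w) :
    dist (act σ x) (act σ y) = dist x y := by
  simp only [dist, act]
  rw [← Finset.map_sdiff, card_map]

theorem sum_act (σ : Equiv.Perm (Fin n)) (u : Slice n w → ℝ) : ∑ y, u (act σ y) = ∑ y, u y := by
  have hinj : Function.Injective (act (w := w) σ) := fun x y hxy =>
    Subtype.ext (map_injective σ.toEmbedding (congrArg Subtype.val hxy))
  exact (Finite.injective_iff_bijective.1 hinj).sum_comp u

theorem act_swap_act_swap (a b : Fin n) (x : Slice n w) :
    act (Equiv.swap a b) (act (Equiv.swap a b) x) = x := by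
  ext c
  simp [act]

theorem sum_laplacian_mul (u v : Slice n w → ℝ) :
    ∑ x, laplacian u x * v x = ∑ x, u x * laplacian v x := by
  have hswap (a b : Fin n) : ∑ x, u (act (Equiv.swap a b) x) * v x =
      ∑ x, u x * v (act (Equiv.swap a b) x) := by
    rw [← sum_act (Equiv.swap a b)]
    simp only [act_swap_act_swap]
  simp only [laplacian, sum_mul, mul_sum]
  rw [sum_comm, sum_comm (s := univ (α := Slice n w))]
  refine sum_congr rfl fun a _ => ?_
  rw [sum_comm, sum_comm (s := univ (α := Slice n w))]
  refine sum_congr rfl fun b _ => ?_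
  simp only [sub_mul, mul_sub, sum_sub_distrib, hswap]

theorem sum_mul_eq_zero_of_laplacian_eq {μ ν : ℝ} (hμν : μ ≠ ν) {u v : Slice n w → ℝ}
    (hu : ∀ x, laplacian u x = μ * u x) (hv : ∀ x, laplacian v x = ν * v x) :
    ∑ x, u x * v x = 0 := by
  have key := sum_laplacian_mul u v
  simp only [hu, hv, mul_left_comm _ ν, mul_assoc, ← mul_sum] at key
  by_contra hne
  exact hμν (mul_right_cancel₀ hne key)

theorem sum_ind_mul_ind (x y : Slice n w) : ∑ a, ind x.1 a * ind y.1 a = w - dist x y := by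
  have h : (dist x y : ℝ) + #(x.1 ∩ y.1) = w := by exact_mod_cast dist_add_card_inter x y
  simp only [ind_mul_ind, sum_ind]
  linarith

theorem ind_act_swap (a b c : Fin n) (x : Slice n w) :
    ind (act (Equiv.swap a b) x).1 c = ind x.1 c -
      (ind x.1 a - ind x.1 b) * ((if c = a then 1 else 0) - (if c = b then 1 else 0)) := by
  have : ind (act (Equiv.swap a b) x).1 c = ind x.1 (Equiv.swap a b c) := by
    simp [ind, act, Finset.mem_map_equiv]
  rw [this, Equiv.swap_apply_def]
  split_ifs <;> subst_vars <;> simp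

theorem dist_act_swap (a b : Fin n) (x y : Slice n w) :
    (dist (act (Equiv.swap a b) x) y : ℝ) = dist x y +
      (ind x.1 a - ind x.1 b) * (ind y.1 a - ind y.1 b) := by
  have hswap := sum_ind_mul_ind (act (Equiv.swap a b) x) y
  simp only [ind_act_swap, sub_mul, mul_sub, sum_sub_distrib, ite_mul, zero_mul,
    mul_ite, mul_one, mul_zero, sum_ite_eq', mem_univ, if_true, sum_ind_mul_ind] at hswap
  linarith

/- The two brackets are the indicators of the transpositions that raise and lower the distance. -/
theorem apply_dist_act_swap (F : ℕ → ℝ) (a b : Fin n) (x y : Slice n w) :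
    F (dist (act (Equiv.swap a b) x) y) - F (dist x y) =
      ((ind x.1 a * ind y.1 a) * ((1 - ind x.1 b) * (1 - ind y.1 b)) +
        ((1 - ind x.1 a) * (1 - ind y.1 a)) * (ind x.1 b * ind y.1 b)) *
          (F (dist x y + 1) - F (dist x y)) +
      ((ind x.1 a * (1 - ind y.1 a)) * ((1 - ind x.1 b) * ind y.1 b) +
        ((1 - ind x.1 a) * ind y.1 a) * (ind x.1 b * (1 - ind y.1 b))) *
          (F (dist x y - 1) - F (dist x y)) := by
  have hd := dist_act_swap a b x y
  set d' := dist (act (Equiv.swap a b) x) y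
  set d := dist x y
  by_cases hax : a ∈ x.1 <;> by_cases hbx : b ∈ x.1 <;> by_cases hay : a ∈ y.1 <;>
    by_cases hby : b ∈ y.1 <;>
    simp only [ind, hax, hbx, hay, hby, if_true, if_false] at hd ⊢ <;> norm_num at hd ⊢
  all_goals first
    | rw [hd]; ring
    | (have hd' : d' = d + 1 := by exact_mod_cast hd
       rw [hd'])
    | (have hd' : d' + 1 = d := by
        have : (d' : ℝ) + 1 = d := by rw [hd]; ring
        exact_mod_cast this
       rw [← hd']; simp)

theorem laplacian_apply_dist (F : ℕ → ℝ) (x y : Slice n w) :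
    laplacian (fun z => F (dist z y)) x = 2 * radialLaplacian n w F (dist x y) := by
  have hxy := sum_ind_mul_ind x y
  have hx : ∑ a, ind x.1 a = w := by rw [sum_ind, x.2]
  have hy : ∑ a, ind y.1 a = w := by rw [sum_ind, y.2]
  have hout : ∑ a, (1 - ind x.1 a) * (1 - ind y.1 a) = (n : ℝ) - w - dist x y := by
    simp only [sub_mul, mul_sub, one_mul, mul_one, sum_sub_distrib, hxy, hx, hy, sum_const,
      card_univ, Fintype.card_fin, nsmul_eq_mul]
    ring
  have hleft : ∑ a, ind x.1 a * (1 - ind y.1 a) = (dist x y : ℝ) := by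
    simp only [mul_sub, mul_one, sum_sub_distrib, hxy, hx, sub_sub_cancel]
  have hright : ∑ a, (1 - ind x.1 a) * ind y.1 a = (dist x y : ℝ) := by
    simp only [sub_mul, one_mul, sum_sub_distrib, hxy, hy, sub_sub_cancel]
  simp only [laplacian, radialLaplacian, apply_dist_act_swap, sum_add_distrib, ← sum_mul,
    ← mul_sum, hxy, hout, hleft, hright]
  ring

theorem laplacian_sum_mul {ι : Type*} (s : Finset ι) (u : ι → Slice n w → ℝ) (c : ι → ℝ)
    (x : Slice n w) :
    laplacian (fun z => ∑ i ∈ s, u i z * c i) x = ∑ i ∈ s, laplacian (u i) x * c i := by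
  simp only [laplacian, ← sum_sub_distrib, ← sub_mul, sum_mul]
  rw [sum_comm (s := s)]
  exact sum_congr rfl fun a _ => sum_comm

theorem exists_sum_mul_eq_apply_dist (F G : ℕ → ℝ) :
    ∃ g : ℕ → ℝ, ∀ x z : Slice n w, ∑ y, F (dist x y) * G (dist y z) = g (dist x z) := by
  have hinv {x z x' z' : Slice n w} (hd : dist x z = dist x' z') :
      ∑ y, F (dist x y) * G (dist y z) = ∑ y, F (dist x' y) * G (dist y z') := by
    obtain ⟨σ, rfl, rfl⟩ := exists_act_eq hd
    rw [← sum_act σ (fun y => F (dist (act σ x) y) * G (dist y (act σ z)))]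
    simp only [dist_act]
  have hex (j : ℕ) : ∃ c : ℝ, ∀ x z : Slice n w, dist x z = j →
      ∑ y, F (dist x y) * G (dist y z) = c := by
    by_cases hj : ∃ x z : Slice n w, dist x z = j
    · obtain ⟨x, z, rfl⟩ := hj
      exact ⟨_, fun x' z' hd => hinv hd⟩
    · exact ⟨0, fun x z hd => absurd ⟨x, z, hd⟩ hj⟩
  choose g hg using hex
  exact ⟨g, fun x z => hg _ x z rfl⟩

theorem sum_apply_dist_eq (F : ℕ → ℝ) (x x' : Slice n w) :
    ∑ y, F (dist x y) = ∑ y, F (dist x' y) := by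
  obtain ⟨g, hg⟩ := exists_sum_mul_eq_apply_dist (n := n) (w := w) F fun _ => 1
  simpa only [mul_one, dist_self] using (hg x x).trans ((hg x' x').trans (by simp)).symm

end Slice

open Slice

/-- The zonal kernel on the Johnson space attached to the Hahn polynomial of index `k`. -/
noncomputable def zonal (n w k : ℕ) : Matrix (Slice n w) (Slice n w) ℝ :=
  Matrix.of fun x y => hahn n w k (dist x y)

/-- The squared norm of a row of the zonal kernel, written as an average over the rows, all of which
have the same norm. -/
noncomputable def rowNorm (n w k : ℕ) : ℝ :=
  (∑ x, ∑ y, zonal n w k x y ^ 2) / Fintype.card (Slice n w)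

theorem zonal_apply (k : ℕ) (x y : Slice n w) : zonal n w k x y = hahn n w k (dist x y) := rfl

theorem zonal_comm (k : ℕ) (x y : Slice n w) : zonal n w k x y = zonal n w k y x := by
  rw [zonal_apply, dist_comm, zonal_apply]

theorem zonal_self (k : ℕ) (x : Slice n w) : zonal n w k x x = 1 := by
  rw [zonal_apply, dist_self, hahn_zero_right]

theorem laplacian_zonal (h : 2 * w ≤ n) {k : ℕ} (hk : k ≤ w) (x y : Slice n w) :
    laplacian (fun z => zonal n w k z y) x = -(2 * (k * (n + 1 - k))) * zonal n w k x y := by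
  simp only [zonal_apply]
  rw [laplacian_apply_dist, radialLaplacian_hahn h hk]
  ring

theorem zonal_mul_zonal_of_ne (h : 2 * w ≤ n) {k l : ℕ} (hk : k ≤ w) (hl : l ≤ w) (hkl : k ≠ l) :
    zonal n w k * zonal n w l = 0 := by
  have hsub : (k : ℝ) - l ≠ 0 := sub_ne_zero.2 (by exact_mod_cast hkl)
  have hadd : (n : ℝ) + 1 - k - l ≠ 0 := by
    have : (k : ℝ) + l ≤ n := by exact_mod_cast (by omega : k + l ≤ n)
    linarith
  have heig : -(2 * ((k : ℝ) * (n + 1 - k))) ≠ -(2 * (l * (n + 1 - l))) := fun heq =>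
    mul_ne_zero hsub hadd (by linear_combination (-1 / 2) * heq)
  ext x z
  rw [Matrix.mul_apply, Matrix.zero_apply]
  simp only [zonal_comm k x]
  exact sum_mul_eq_zero_of_laplacian_eq heig (fun y => laplacian_zonal h hk y x)
    (fun y => laplacian_zonal h hl y z)

theorem sum_zonal_sq (k : ℕ) (x : Slice n w) : ∑ y, zonal n w k x y ^ 2 = rowNorm n w k := by
  have hrow (x' : Slice n w) : ∑ y, zonal n w k x' y ^ 2 = ∑ y, zonal n w k x y ^ 2 :=
    sum_apply_dist_eq (fun j => hahn n w k j ^ 2) x' x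
  have hcard : (Fintype.card (Slice n w) : ℝ) ≠ 0 :=
    Nat.cast_ne_zero.2 (Fintype.card_pos_iff.2 ⟨x⟩).ne'
  rw [rowNorm, sum_congr rfl fun x' _ => hrow x', sum_const, card_univ, nsmul_eq_mul,
    mul_div_cancel_left₀ _ hcard]

theorem rowNorm_pos (h : 2 * w ≤ n) (k : ℕ) : 0 < rowNorm n w k := by
  obtain ⟨x⟩ := nonempty h
  have hle : zonal n w k x x ^ 2 ≤ ∑ y, zonal n w k x y ^ 2 :=
    single_le_sum (f := fun y => zonal n w k x y ^ 2) (fun y _ => sq_nonneg _) (mem_univ x)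
  rw [zonal_self, sum_zonal_sq] at hle
  linarith

/- The square of a zonal kernel is a function of the distance and an eigenfunction of the Laplacian
with the same eigenvalue, hence a multiple of the kernel. -/
theorem zonal_mul_self (h : 2 * w ≤ n) {k : ℕ} (hk : k ≤ w) :
    zonal n w k * zonal n w k = rowNorm n w k • zonal n w k := by
  obtain ⟨g, hg⟩ := exists_sum_mul_eq_apply_dist (n := n) (w := w) (hahn n w k) (hahn n w k)
  have hg0 : g 0 = rowNorm n w k := by
    obtain ⟨x⟩ := nonempty h
    rw [← dist_self x, ← hg, ← sum_zonal_sq k x]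
    exact sum_congr rfl fun y _ => by rw [dist_comm y x, zonal_apply, sq]
  have hgr : ∀ j ≤ w, radialLaplacian n w g j = -(k * (n + 1 - k)) * g j := by
    intro j hj
    obtain ⟨x, z, rfl⟩ := exists_dist_eq h hj
    have hlap := laplacian_apply_dist g x z
    simp only [← hg, laplacian_sum_mul, laplacian_apply_dist, radialLaplacian_hahn h hk] at hlap ⊢
    simp only [mul_assoc, ← mul_sum] at hlap ⊢
    linarith
  have hQ : ∀ j ≤ w, radialLaplacian n w (fun j => rowNorm n w k * hahn n w k j) j =
      -(k * (n + 1 - k)) * (rowNorm n w k * hahn n w k j) := fun j _ => by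
    have := radialLaplacian_hahn h hk j
    rw [radialLaplacian] at this ⊢
    linear_combination rowNorm n w k * this
  ext x z
  rw [Matrix.mul_apply, Matrix.smul_apply, smul_eq_mul, zonal_apply]
  exact (hg x z).trans (eq_of_radialLaplacian_eq h (by rw [hg0, hahn_zero_right, mul_one]) hgr hQ _
    (dist_le x z))

theorem posSemidef_zonal (h : 2 * w ≤ n) {k : ℕ} (hk : k ≤ w) : (zonal n w k).PosSemidef := by
  have htrans : (zonal n w k).conjTranspose = zonal n w k := by
    ext x y
    exact zonal_comm k y x
  have hsq := (Matrix.posSemidef_conjTranspose_mul_self (zonal n w k)).smul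
    (inv_nonneg.2 (rowNorm_pos h k).le)
  rwa [htrans, zonal_mul_self h hk, inv_smul_smul₀ (rowNorm_pos h k).ne'] at hsq

end Johnson

/-! ### The linear programming bound for constant-weight codes -/

namespace Johnson

open Finset

section PosSemidef

variable {X : Type*} {K : Matrix X X ℝ}

theorem sum_sum_mul_nonneg [Fintype X] (hK : K.PosSemidef) (v : X → ℝ) :
    0 ≤ ∑ x, ∑ y, v x * (K x y * v y) := by
  simpa [dotProduct, Matrix.mulVec, mul_sum] using hK.dotProduct_mulVec_nonneg v

theorem sum_sum_nonneg [Finite X] (hK : K.PosSemidef) (C : Finset X) :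
    0 ≤ ∑ x ∈ C, ∑ y ∈ C, K x y := by
  classical
  have := Fintype.ofFinite X
  simpa [sum_ite_mem] using sum_sum_mul_nonneg hK fun x => if x ∈ C then 1 else 0

/- The left side is what the all-ones vector, an eigenvector of `K`, contributes to the quadratic
form of `K` at the indicator of `C`. -/
theorem card_sq_mul_le_sum_sum [Fintype X] (hK : K.PosSemidef) {r : ℝ}
    (hr : ∀ x, ∑ y, K x y = r) (C : Finset X) :
    (#C : ℝ) ^ 2 * r ≤ Fintype.card X * ∑ x ∈ C, ∑ y ∈ C, K x y := by
  classical
  rcases C.eq_empty_or_nonempty with rfl | ⟨o, -⟩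
  · simp
  set N : ℝ := (Fintype.card X : ℝ)
  have hN : 0 < N := Nat.cast_pos.2 (Fintype.card_pos_iff.2 ⟨o⟩)
  have hcol (y : X) : ∑ x, K x y = r := by
    rw [← hr y]
    exact sum_congr rfl fun x _ => hK.isHermitian.apply y x
  have hcols : ∑ x, ∑ y ∈ C, K x y = #C * r :=
    sum_comm.trans (by rw [sum_congr rfl fun y _ => hcol y, sum_const, nsmul_eq_mul])
  have hinner (x : X) : ∑ y, K x y * (N * (if y ∈ C then 1 else 0) - #C) =
      N * ∑ y ∈ C, K x y - #C * r := by
    simp only [mul_sub, sum_sub_distrib, ← sum_mul, hr, mul_ite, mul_one, mul_zero, sum_ite_mem,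
      univ_inter]
    ring
  have hform := sum_sum_mul_nonneg hK fun x => N * (if x ∈ C then 1 else 0) - #C
  simp only [← mul_sum, hinner] at hform
  have hexpand : ∑ x, (N * (if x ∈ C then 1 else 0) - #C) * (N * ∑ y ∈ C, K x y - #C * r) =
      N * (N * ∑ x ∈ C, ∑ y ∈ C, K x y - #C ^ 2 * r) := by
    simp only [sub_mul, mul_ite, mul_one, mul_zero, ite_mul, zero_mul, sum_sub_distrib,
      sum_ite_mem, univ_inter, ← mul_sum, mul_sub, hcols, sum_const, card_univ, nsmul_eq_mul]
    ring
  rw [hexpand] at hform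
  linarith [nonneg_of_mul_nonneg_right hform hN]

variable {δ : X → X → ℝ} {τ d A r : ℝ} {C : Finset X}

theorem mul_sum_sum_sq_le [Finite X] (hδ : ∀ x, δ x x = 0) (hK : K.PosSemidef)
    (hτ : (Matrix.of fun x y => (τ - δ x y) * K x y).PosSemidef) (hA : ∀ x, K x x = A)
    (hC : ∀ x ∈ C, ∀ y ∈ C, x ≠ y → d ≤ δ x y) :
    (d - τ) * ∑ x ∈ C, ∑ y ∈ C, K x y ^ 2 ≤ #C * (d * A ^ 2) := by
  classical
  have hnonneg : 0 ≤ ∑ x ∈ C, ∑ y ∈ C, (τ - δ x y) * K x y * K x y :=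
    sum_sum_nonneg (hτ.hadamard hK) C
  have hsplit : ∑ x ∈ C, ∑ y ∈ C, (d - δ x y) * K x y ^ 2 =
      (d - τ) * ∑ x ∈ C, ∑ y ∈ C, K x y ^ 2 +
        ∑ x ∈ C, ∑ y ∈ C, (τ - δ x y) * K x y * K x y := by
    simp only [mul_sum, ← sum_add_distrib]
    exact sum_congr rfl fun x _ => sum_congr rfl fun y _ => by ring
  have hrow (x) (hx : x ∈ C) : ∑ y ∈ C, (d - δ x y) * K x y ^ 2 ≤ d * A ^ 2 := by
    have hoff : ∑ y ∈ C.erase x, (d - δ x y) * K x y ^ 2 ≤ 0 := sum_nonpos fun y hy =>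
      mul_nonpos_of_nonpos_of_nonneg
        (sub_nonpos.2 (hC x hx y (mem_of_mem_erase hy) (ne_of_mem_erase hy).symm)) (sq_nonneg _)
    rw [← add_sum_erase C _ hx, hδ, hA, sub_zero]
    linarith
  have hle : ∑ x ∈ C, ∑ y ∈ C, (d - δ x y) * K x y ^ 2 ≤ #C * (d * A ^ 2) :=
    (sum_le_sum hrow).trans_eq (by rw [sum_const, nsmul_eq_mul])
  linarith

theorem card_mul_le_of_posSemidef [Fintype X] (hδ : ∀ x, δ x x = 0) (hK : K.PosSemidef)
    (hτ : (Matrix.of fun x y => (τ - δ x y) * K x y).PosSemidef) (hA : ∀ x, K x x = A)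
    (hr : ∀ x, ∑ y, K x y ^ 2 = r) (hd : τ ≤ d) (hne : C.Nonempty)
    (hC : ∀ x ∈ C, ∀ y ∈ C, x ≠ y → d ≤ δ x y) :
    #C * (d - τ) * r ≤ Fintype.card X * (d * A ^ 2) := by
  have hmean : (#C : ℝ) ^ 2 * r ≤ Fintype.card X * ∑ x ∈ C, ∑ y ∈ C, K x y ^ 2 := by
    simp only [sq (K _ _)]
    exact card_sq_mul_le_sum_sum (hK.hadamard hK)
      (fun x => by simp only [Matrix.hadamard_apply, ← sq, hr x]) C
  have htest := mul_sum_sum_sq_le hδ hK hτ hA hC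
  refine le_of_mul_le_mul_left ?_ (Nat.cast_pos (α := ℝ).2 hne.card_pos)
  calc (#C : ℝ) * (#C * (d - τ) * r) = (d - τ) * (#C ^ 2 * r) := by ring
    _ ≤ (d - τ) * (Fintype.card X * ∑ x ∈ C, ∑ y ∈ C, K x y ^ 2) :=
      mul_le_mul_of_nonneg_left hmean (sub_nonneg.2 hd)
    _ = Fintype.card X * ((d - τ) * ∑ x ∈ C, ∑ y ∈ C, K x y ^ 2) := by ring
    _ ≤ Fintype.card X * (#C * (d * A ^ 2)) := mul_le_mul_of_nonneg_left htest (Nat.cast_nonneg _)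
    _ = #C * (Fintype.card X * (d * A ^ 2)) := by ring

end PosSemidef

theorem sum_sq_mul_le {ι : Type*} {s : Finset ι} {a b c : ι → ℝ} {X : ℝ} (hX : 0 ≤ X)
    (hb : ∀ i ∈ s, 0 ≤ b i) (hc : ∀ i ∈ s, 0 ≤ c i) (h : ∀ i ∈ s, X ≤ b i * c i) :
    (∑ i ∈ s, a i) ^ 2 * X ≤ (∑ i ∈ s, a i ^ 2 * c i) * ∑ i ∈ s, b i := by
  calc (∑ i ∈ s, a i) ^ 2 * X = (∑ i ∈ s, a i * √X) ^ 2 := by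
        rw [← sum_mul, mul_pow, Real.sq_sqrt hX]
    _ ≤ (∑ i ∈ s, a i ^ 2 * c i) * ∑ i ∈ s, b i := by
        refine sum_sq_le_sum_mul_sum_of_sq_le_mul _
          (fun i hi => mul_nonneg (sq_nonneg _) (hc i hi)) hb fun i hi => ?_
        rw [mul_pow, Real.sq_sqrt hX, mul_assoc, mul_comm (c i)]
        exact mul_le_mul_of_nonneg_left (h i hi) (sq_nonneg _)

theorem sum_mul_three_term (u m v z : ℕ → ℝ) {g : ℕ → ℝ} {t : ℕ} (hg0 : g 0 = 0)
    (hgt : ∀ k, t < k → g k = 0) :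
    ∑ k ∈ range (t + 1), g k * (u k * z (k + 1) + m k * z k + v k * z (k - 1)) =
      g 1 * v 1 * z 0 + ∑ k ∈ range (t + 1),
        (g k * u k + m (k + 1) * g (k + 1) + g (k + 2) * v (k + 2)) * z (k + 1) := by
  have hm : ∑ k ∈ range (t + 1), m (k + 1) * g (k + 1) * z (k + 1) =
      ∑ k ∈ range (t + 1), m k * g k * z k := by
    rw [sum_range_succ, sum_range_succ', hg0, hgt (t + 1) (by omega)]
    simp
  have hv : g 1 * v 1 * z 0 + ∑ k ∈ range (t + 1), g (k + 2) * v (k + 2) * z (k + 1) =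
      ∑ k ∈ range (t + 1), g k * v k * z (k - 1) := by
    rw [add_comm, ← sum_range_succ' (fun k => g (k + 1) * v (k + 1) * z k),
      sum_range_succ, sum_range_succ, hgt (t + 1) (by omega), hgt (t + 1 + 1) (by omega),
      sum_range_succ', hg0]
    simp
  simp only [add_mul, sum_add_distrib]
  rw [hm, add_left_comm, hv]
  simp only [← sum_add_distrib]
  exact sum_congr rfl fun k _ => by ring

open Slice

variable {n w : ℕ}

theorem birthRate_pos (h : 2 * w ≤ n) {k : ℕ} (hk : k < w) : 0 < birthRate n w k := by
  have hk' : (k : ℝ) + 1 ≤ w := by exact_mod_cast hk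
  have h' : 2 * (w : ℝ) ≤ n := by exact_mod_cast h
  have : (0 : ℝ) ≤ k := k.cast_nonneg
  exact div_pos (mul_pos (mul_pos (by linarith) (by linarith)) (by linarith))
    (mul_pos (by linarith) (by linarith))

theorem deathRate_pos (h : 2 * w ≤ n) {k : ℕ} (hk0 : 0 < k) (hk : k ≤ w) :
    0 < deathRate n w k := by
  have hk' : (k : ℝ) ≤ w := by exact_mod_cast hk
  have h' : 2 * (w : ℝ) ≤ n := by exact_mod_cast h
  have hk0' : (0 : ℝ) < k := by exact_mod_cast hk0
  exact div_pos (mul_pos (mul_pos hk0' (by linarith)) (by linarith))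
    (mul_pos (by linarith) (by linarith))

/- At `k = 0` the truncated subtraction is harmless, since `deathRate n w 0 = 0`. -/
theorem neg_dist_mul_zonal (h : 2 * w ≤ n) {k : ℕ} (hk : 2 * k < n) (x y : Slice n w) :
    -(dist x y * zonal n w k x y) =
      birthRate n w k * (zonal n w (k + 1) x y - zonal n w k x y) +
        deathRate n w k * (zonal n w (k - 1) x y - zonal n w k x y) := by
  simp only [zonal_apply]
  rw [neg_mul_hahn h (by exact_mod_cast hk) (dist_le x y)]
  cases k with
  | zero => simp [deathRate]
  | succ k => simp

theorem sum_zonal_mul_zonal (h : 2 * w ≤ n) {k l : ℕ} (hk : k ≤ w) (hl : l ≤ w) (x : Slice n w) :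
    ∑ y, zonal n w k x y * zonal n w l x y = if k = l then rowNorm n w k else 0 := by
  split_ifs with hkl
  · subst hkl
    simp only [← sq, sum_zonal_sq]
  · have hzero := congrFun (congrFun (zonal_mul_zonal_of_ne h hk hl hkl) x) x
    rw [Matrix.mul_apply, Matrix.zero_apply] at hzero
    rw [← hzero]
    exact sum_congr rfl fun y _ => by rw [zonal_comm l x y]

theorem sum_neg_dist_mul_zonal_mul_zonal (h : 2 * w ≤ n) {k l : ℕ} (hk : k < w) (hl : l ≤ w)
    (x : Slice n w) :
    ∑ y, -(dist x y * zonal n w k x y) * zonal n w l x y =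
      birthRate n w k * ((if k + 1 = l then rowNorm n w (k + 1) else 0) -
        if k = l then rowNorm n w k else 0) +
      deathRate n w k * ((if k - 1 = l then rowNorm n w (k - 1) else 0) -
        if k = l then rowNorm n w k else 0) := by
  rw [← sum_zonal_mul_zonal h hk hl x, ← sum_zonal_mul_zonal h hk.le hl x,
    ← sum_zonal_mul_zonal h ((Nat.sub_le k 1).trans hk.le) hl x]
  simp only [neg_dist_mul_zonal h (by omega : 2 * k < n), add_mul, sub_mul, mul_sub,
    sum_add_distrib, sum_sub_distrib, mul_assoc, mul_sum]

theorem deathRate_mul_rowNorm (h : 2 * w ≤ n) {k : ℕ} (hk : k + 1 < w) :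
    deathRate n w (k + 1 : ℕ) * rowNorm n w k = birthRate n w k * rowNorm n w (k + 1) := by
  obtain ⟨x⟩ := nonempty h
  have hdown := sum_neg_dist_mul_zonal_mul_zonal h hk (l := k) (by omega) x
  have hup := sum_neg_dist_mul_zonal_mul_zonal h (k := k) (l := k + 1) (by omega) hk.le x
  simp only [add_tsub_cancel_right, if_true, if_neg (by omega : ¬k + 1 + 1 = k),
    if_neg (by omega : ¬k + 1 = k), if_neg (by omega : ¬k = k + 1),
    if_neg (by omega : ¬k - 1 = k + 1), sub_zero, mul_zero, zero_add, add_zero] at hdown hup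
  rw [← hdown, ← hup]
  exact sum_congr rfl fun y _ => by ring

theorem choose_mul_birthRate_le (h : 2 * w ≤ n) {k : ℕ} (hk : k + 1 < w) :
    n.choose k * birthRate n w k ≤ n.choose (k + 1) * deathRate n w (k + 1 : ℕ) := by
  have hkw : (k : ℝ) + 2 ≤ w := by exact_mod_cast hk
  have hwn : 2 * (w : ℝ) ≤ n := by exact_mod_cast h
  have : (0 : ℝ) ≤ k := k.cast_nonneg
  have hchoose : (n.choose (k + 1) : ℝ) * (k + 1) = n.choose k * ((n : ℝ) - k) := by
    rw [← Nat.cast_sub (by omega)]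
    exact_mod_cast Nat.choose_succ_right_eq n k
  have hdeath : (n.choose (k + 1) : ℝ) * deathRate n w (k + 1 : ℕ) =
      (n.choose k * (((w : ℝ) - k) * (n - w - k))) *
        ((n - k) / ((n - 2 * k) * (n - 1 - 2 * k))) := by
    rw [deathRate]
    push_cast
    rw [show (n : ℝ) + 2 - 2 * (k + 1) = n - 2 * k by ring,
      show (n : ℝ) + 1 - 2 * (k + 1) = n - 1 - 2 * k by ring, mul_div_assoc', mul_div_assoc']
    congr 1
    linear_combination (((n : ℝ) - w - k) * (w - k)) * hchoose
  have hbirth : (n.choose k : ℝ) * birthRate n w k =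
      (n.choose k * (((w : ℝ) - k) * (n - w - k))) *
        ((n + 1 - k) / ((n - 2 * k) * (n + 1 - 2 * k))) := by
    rw [birthRate]
    ring
  have hratio : ((n : ℝ) + 1 - k) / ((n - 2 * k) * (n + 1 - 2 * k)) ≤
      (n - k) / ((n - 2 * k) * (n - 1 - 2 * k)) := by
    rw [div_mul_eq_div_div_swap, div_mul_eq_div_div_swap]
    refine div_le_div_of_nonneg_right ?_ (by linarith)
    rw [div_le_div_iff₀ (by linarith) (by linarith)]
    nlinarith
  rw [hdeath, hbirth]
  exact mul_le_mul_of_nonneg_left hratio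
    (mul_nonneg (Nat.cast_nonneg _) (mul_nonneg (by linarith) (by linarith)))

/- The `k`-th eigenspace has dimension `Fintype.card (Slice n w) / rowNorm n w k`. -/
theorem card_le_choose_mul_rowNorm (h : 2 * w ≤ n) {k : ℕ} (hk : k < w) :
    (Fintype.card (Slice n w) : ℝ) ≤ n.choose k * rowNorm n w k := by
  induction k with
  | zero =>
    obtain ⟨x⟩ := nonempty h
    simp [← sum_zonal_sq 0 x, zonal_apply, hahn_zero_left]
  | succ k ih =>
    have hdeath := deathRate_pos h k.succ_pos hk.le
    refine le_of_mul_le_mul_left ?_ hdeath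
    calc deathRate n w (k + 1 : ℕ) * Fintype.card (Slice n w)
        ≤ deathRate n w (k + 1 : ℕ) * (n.choose k * rowNorm n w k) :=
          mul_le_mul_of_nonneg_left (ih (Nat.lt_of_succ_lt hk)) hdeath.le
      _ = n.choose k * birthRate n w k * rowNorm n w (k + 1) := by
          linear_combination (n.choose k : ℝ) * deathRate_mul_rowNorm h hk
      _ ≤ n.choose (k + 1) * deathRate n w (k + 1 : ℕ) * rowNorm n w (k + 1) :=
          mul_le_mul_of_nonneg_right (choose_mul_birthRate_le h hk) (rowNorm_pos h _).le
      _ = deathRate n w (k + 1 : ℕ) * (n.choose (k + 1) * rowNorm n w (k + 1)) := by ring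

/-- The zonal kernel with coefficients `g 0, …, g t`, which is the test kernel of the linear
programming bound. -/
noncomputable def zonalSum (n w t : ℕ) (g : ℕ → ℝ) : Matrix (Slice n w) (Slice n w) ℝ :=
  ∑ k ∈ range (t + 1), g k • zonal n w k

/-- The coefficient of `zonal n w (k + 1)` in the expansion of the kernel
`(τ - dist x y) * ∑ k, g k * zonal n w k x y`. -/
noncomputable def shiftedCoeff (n w : ℕ) (τ : ℝ) (g : ℕ → ℝ) (k : ℕ) : ℝ :=
  g k * birthRate n w k +
    (τ - birthRate n w (k + 1 : ℕ) - deathRate n w (k + 1 : ℕ)) * g (k + 1) +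
    g (k + 2) * deathRate n w (k + 2 : ℕ)

theorem zonalSum_apply (t : ℕ) (g : ℕ → ℝ) (x y : Slice n w) :
    zonalSum n w t g x y = ∑ k ∈ range (t + 1), g k * zonal n w k x y := by
  simp only [zonalSum, Matrix.sum_apply, Matrix.smul_apply, smul_eq_mul]

theorem sum_zonalSum_sq (h : 2 * w ≤ n) {t : ℕ} (ht : t ≤ w) (g : ℕ → ℝ) (x : Slice n w) :
    ∑ y, zonalSum n w t g x y ^ 2 = ∑ k ∈ range (t + 1), g k ^ 2 * rowNorm n w k := by
  have hle {k : ℕ} (hk : k ∈ range (t + 1)) : k ≤ w := (mem_range_succ_iff.1 hk).trans ht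
  simp only [zonalSum_apply, sq, sum_mul_sum, mul_mul_mul_comm (g _) _ (g _)]
  rw [sum_comm]
  refine sum_congr rfl fun k hk => ?_
  rw [sum_comm]
  simp only [← mul_sum]
  rw [sum_congr rfl fun l hl => by rw [sum_zonal_mul_zonal h (hle hk) (hle hl)]]
  simp only [mul_ite, mul_zero, sum_ite_eq, hk, if_true]

theorem sub_dist_mul_zonalSum (h : 2 * w ≤ n) {t : ℕ} (ht : t < w) {g : ℕ → ℝ} (hg0 : g 0 = 0)
    (hgt : ∀ k, t < k → g k = 0) (τ : ℝ) (x y : Slice n w) :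
    (τ - dist x y) * zonalSum n w t g x y = g 1 * deathRate n w (1 : ℕ) * zonal n w 0 x y +
      ∑ k ∈ range (t + 1), shiftedCoeff n w τ g k * zonal n w (k + 1) x y := by
  simp only [shiftedCoeff]
  rw [← sum_mul_three_term (fun k => birthRate n w k)
    (fun k => τ - birthRate n w k - deathRate n w k) (fun k => deathRate n w k)
    (fun k => zonal n w k x y) hg0 hgt, zonalSum_apply, mul_sum]
  refine sum_congr rfl fun k hk => ?_
  have hk := mem_range_succ_iff.1 hk
  linear_combination g k * neg_dist_mul_zonal h (by omega : 2 * k < n) x y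

theorem posSemidef_zonalSum (h : 2 * w ≤ n) {t : ℕ} (ht : t ≤ w) {g : ℕ → ℝ}
    (hg : ∀ k, 0 ≤ g k) : (zonalSum n w t g).PosSemidef :=
  Matrix.posSemidef_sum _ fun k hk =>
    (posSemidef_zonal h ((mem_range_succ_iff.1 hk).trans ht)).smul (hg k)

theorem posSemidef_sub_dist_mul_zonalSum (h : 2 * w ≤ n) {t : ℕ} (ht : t < w) {g : ℕ → ℝ}
    (hg : ∀ k, 0 ≤ g k) (hg0 : g 0 = 0) (hgt : ∀ k, t < k → g k = 0) {τ : ℝ}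
    (hshift : ∀ k ≤ t, 0 ≤ shiftedCoeff n w τ g k) :
    (Matrix.of fun x y => (τ - dist x y) * zonalSum n w t g x y).PosSemidef := by
  have heq : (Matrix.of fun x y => (τ - dist x y) * zonalSum n w t g x y) =
      (g 1 * deathRate n w (1 : ℕ)) • zonal n w 0 +
        ∑ k ∈ range (t + 1), shiftedCoeff n w τ g k • zonal n w (k + 1) := by
    ext x y
    simp only [Matrix.of_apply, sub_dist_mul_zonalSum h ht hg0 hgt, Matrix.add_apply,
      Matrix.sum_apply, Matrix.smul_apply, smul_eq_mul]
  rw [heq]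
  refine ((posSemidef_zonal h w.zero_le).smul
    (mul_nonneg (hg 1) (deathRate_pos h one_pos (by omega)).le)).add
    (Matrix.posSemidef_sum _ fun k hk => ?_)
  have hk := mem_range_succ_iff.1 hk
  exact (posSemidef_zonal h (by omega)).smul (hshift k hk)

theorem card_code_le (h : 2 * w ≤ n) {t : ℕ} (ht : t < w) {g : ℕ → ℝ} (hg : ∀ k, 0 ≤ g k)
    (hg0 : g 0 = 0) (hgt : ∀ k, t < k → g k = 0) (hpos : ∃ k, 0 < g k) {τ d : ℝ} (hτ : 0 ≤ τ)
    (hd : τ ≤ d) (hshift : ∀ k ≤ t, 0 ≤ shiftedCoeff n w τ g k) (C : Finset (Slice n w))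
    (hC : ∀ x ∈ C, ∀ y ∈ C, x ≠ y → d ≤ dist x y) :
    #C * (d - τ) ≤ d * ∑ k ∈ range (t + 1), (n.choose k : ℝ) := by
  have hd0 : 0 ≤ d := hτ.trans hd
  rcases C.eq_empty_or_nonempty with rfl | hne
  · rw [card_empty, Nat.cast_zero, zero_mul]
    positivity
  have hrow : 0 < ∑ k ∈ range (t + 1), g k ^ 2 * rowNorm n w k := by
    obtain ⟨k, hk⟩ := hpos
    have hkt : k ≤ t := not_lt.1 fun hc => hk.ne' (hgt k hc)
    exact sum_pos' (fun l _ => mul_nonneg (sq_nonneg _) (rowNorm_pos h l).le)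
      ⟨k, mem_range_succ_iff.2 hkt, mul_pos (pow_pos hk 2) (rowNorm_pos h k)⟩
  have hdelsarte := card_mul_le_of_posSemidef (δ := fun x y : Slice n w => (dist x y : ℝ))
    (fun x => by rw [dist_self, Nat.cast_zero]) (posSemidef_zonalSum h ht.le hg)
    (posSemidef_sub_dist_mul_zonalSum h ht hg hg0 hgt hshift) (A := ∑ k ∈ range (t + 1), g k)
    (fun x => by simp only [zonalSum_apply, zonal_self, mul_one]) (sum_zonalSum_sq h ht.le g) hd
    hne hC
  have hcauchy : (∑ k ∈ range (t + 1), g k) ^ 2 * Fintype.card (Slice n w) ≤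
      (∑ k ∈ range (t + 1), g k ^ 2 * rowNorm n w k) * ∑ k ∈ range (t + 1), (n.choose k : ℝ) :=
    sum_sq_mul_le (Nat.cast_nonneg _) (fun k _ => Nat.cast_nonneg _)
      (fun k _ => (rowNorm_pos h k).le) fun k hk =>
        card_le_choose_mul_rowNorm h ((mem_range_succ_iff.1 hk).trans_lt ht)
  refine le_of_mul_le_mul_right ?_ hrow
  linarith [mul_le_mul_of_nonneg_left hcauchy hd0]

end Johnson

namespace Johnson

open Finset Slice Real

/-- The test sequence of the linear programming bound: `m ↦ ρ ^ m * sin (m * π / (L + 1))` for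
`0 ≤ m ≤ L`, moved to start at the index `s` and extended by zero. It is the Perron eigenvector of
a tridiagonal matrix with constant diagonals. -/
noncomputable def sineWindow (s L : ℕ) (ρ : ℝ) (k : ℕ) : ℝ :=
  if k ≤ s + L then ρ ^ (k - s) * sin ((k - s : ℕ) * (π / (L + 1))) else 0

section SineWindow

variable {s L : ℕ} {ρ : ℝ}

theorem natCast_mul_pi_div_le (L : ℕ) {m : ℕ} (hm : m ≤ L + 1) : (m : ℝ) * (π / (L + 1)) ≤ π := by
  rw [mul_div_assoc', div_le_iff₀ (by positivity), mul_comm π]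
  exact mul_le_mul_of_nonneg_right (by exact_mod_cast hm) pi_pos.le

theorem sineWindow_of_le {k : ℕ} (hk : k ≤ s) : sineWindow s L ρ k = 0 := by
  simp [sineWindow, Nat.sub_eq_zero_of_le hk]

theorem sineWindow_of_lt {k : ℕ} (hk : s + L < k) : sineWindow s L ρ k = 0 :=
  if_neg hk.not_ge

theorem sineWindow_add {m : ℕ} (hm : m ≤ L + 1) :
    sineWindow s L ρ (s + m) = ρ ^ m * sin (m * (π / (L + 1))) := by
  rcases hm.eq_or_lt with rfl | hm
  · rw [sineWindow_of_lt (by omega)]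
    push_cast
    rw [mul_div_cancel₀ _ (by positivity), sin_pi, mul_zero]
  · rw [sineWindow, if_pos (by omega), Nat.add_sub_cancel_left]

theorem sineWindow_nonneg (hρ : 0 ≤ ρ) (k : ℕ) : 0 ≤ sineWindow s L ρ k := by
  rw [sineWindow]
  split_ifs with hk
  · exact mul_nonneg (by positivity)
      (sin_nonneg_of_nonneg_of_le_pi (by positivity) (natCast_mul_pi_div_le L (by omega)))
  · exact le_rfl

theorem sineWindow_succ_pos (hL : 1 ≤ L) (hρ : 0 < ρ) : 0 < sineWindow s L ρ (s + 1) := by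
  have hL' : (1 : ℝ) ≤ L := by exact_mod_cast hL
  rw [sineWindow_add (by omega), Nat.cast_one, one_mul]
  exact mul_pos (by positivity)
    (sin_pos_of_pos_of_lt_pi (by positivity) (div_lt_self pi_pos (by linarith)))

theorem sineWindow_recurrence {m : ℕ} (hm : m < L) :
    ρ ^ 2 * sineWindow s L ρ (s + m) + sineWindow s L ρ (s + m + 2) =
      2 * ρ * cos (π / (L + 1)) * sineWindow s L ρ (s + m + 1) := by
  rw [add_assoc, add_assoc, sineWindow_add (by omega), sineWindow_add (by omega),
    sineWindow_add (by omega)]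
  generalize π / ((L : ℝ) + 1) = θ
  have hsin : sin (m * θ) + sin ((m + 2 : ℕ) * θ) = 2 * cos θ * sin ((m + 1 : ℕ) * θ) := by
    rw [show (m : ℝ) * θ = (m + 1 : ℕ) * θ - θ by push_cast; ring,
      show ((m + 2 : ℕ) : ℝ) * θ = (m + 1 : ℕ) * θ + θ by push_cast; ring, sin_sub, sin_add]
    ring
  linear_combination ρ ^ (m + 2) * hsin

end SineWindow

variable {n w : ℕ}

theorem shiftedCoeff_sineWindow_nonneg (h : 2 * w ≤ n) {s L : ℕ} (ht : s + L < w)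
    {ρ q e τ : ℝ} (hρ : 0 ≤ ρ)
    (hbirth : ∀ k, s ≤ k → k ≤ s + L + 1 → ρ ^ 2 * q ≤ birthRate n w k)
    (hdeath : ∀ k, s ≤ k → k ≤ s + L + 1 → q ≤ deathRate n w k)
    (hsum : ∀ k, s ≤ k → k ≤ s + L + 1 → birthRate n w k + deathRate n w k ≤ e)
    (hτ : e - 2 * (ρ * q) * cos (π / (L + 1)) ≤ τ) {k : ℕ} (hk : k ≤ s + L) :
    0 ≤ shiftedCoeff n w τ (sineWindow s L ρ) k := by
  have hg := sineWindow_nonneg (s := s) (L := L) hρ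
  have hleft : 0 ≤ sineWindow s L ρ k * birthRate n w k :=
    mul_nonneg (hg k) (birthRate_pos h (by omega)).le
  have hright : 0 ≤ sineWindow s L ρ (k + 2) * deathRate n w (k + 2 : ℕ) := by
    rcases le_or_gt (k + 2) w with hkw | hkw
    · exact mul_nonneg (hg _) (deathRate_pos h (by omega) hkw).le
    · rw [sineWindow_of_lt (by omega), zero_mul]
  rw [shiftedCoeff]
  rcases lt_or_ge k s with hks | hks
  · rw [sineWindow_of_le (by omega : k + 1 ≤ s), mul_zero, add_zero]
    exact add_nonneg hleft hright
  rcases hk.eq_or_lt with rfl | hk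
  · rw [sineWindow_of_lt (by omega : s + L < s + L + 1), mul_zero, add_zero]
    exact add_nonneg hleft hright
  obtain ⟨m, rfl⟩ := Nat.exists_eq_add_of_le hks
  have hrec := sineWindow_recurrence (s := s) (ρ := ρ) (by omega : m < L)
  have hmid := hsum (s + m + 1) (by omega) (by omega)
  calc 0 ≤ (τ - (e - 2 * (ρ * q) * cos (π / (L + 1)))) * sineWindow s L ρ (s + m + 1) :=
        mul_nonneg (sub_nonneg.2 hτ) (hg _)
    _ = sineWindow s L ρ (s + m) * (ρ ^ 2 * q) + (τ - e) * sineWindow s L ρ (s + m + 1) +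
          sineWindow s L ρ (s + m + 2) * q := by linear_combination -q * hrec
    _ ≤ _ := add_le_add (add_le_add
        (mul_le_mul_of_nonneg_left (hbirth _ (by omega) (by omega)) (hg _))
        (mul_le_mul_of_nonneg_right (by linarith) (hg _)))
        (mul_le_mul_of_nonneg_left (hdeath _ (by omega) (by omega)) (hg _))

theorem card_code_le_of_window (h : 2 * w ≤ n) {s L : ℕ} (hL : 1 ≤ L) (ht : s + L < w)
    {p q e τ d : ℝ} (hp : 0 < p) (hq : 0 < q)
    (hbirth : ∀ k, s ≤ k → k ≤ s + L + 1 → p ≤ birthRate n w k)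
    (hdeath : ∀ k, s ≤ k → k ≤ s + L + 1 → q ≤ deathRate n w k)
    (hsum : ∀ k, s ≤ k → k ≤ s + L + 1 → birthRate n w k + deathRate n w k ≤ e)
    (hτ : e - 2 * √(p * q) * cos (π / (L + 1)) ≤ τ) (hτ0 : 0 ≤ τ) (hd : τ ≤ d)
    (C : Finset (Slice n w)) (hC : ∀ x ∈ C, ∀ y ∈ C, x ≠ y → d ≤ dist x y) :
    #C * (d - τ) ≤ d * ∑ k ∈ range (s + L + 1), (n.choose k : ℝ) := by
  have hρ : 0 < √(p / q) := sqrt_pos.2 (div_pos hp hq)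
  have hsq : √(p / q) ^ 2 * q = p := by
    rw [sq_sqrt (div_pos hp hq).le, div_mul_cancel₀ _ hq.ne']
  have hmul : √(p / q) * q = √(p * q) := by
    rw [← sqrt_sq (mul_pos hρ hq).le, mul_pow, sq q, ← mul_assoc, hsq]
  refine card_code_le h ht (sineWindow_nonneg hρ.le) (sineWindow_of_le s.zero_le)
    (fun k => sineWindow_of_lt) ⟨s + 1, sineWindow_succ_pos hL hρ⟩ hτ0 hd (fun k hk => ?_) C hC
  exact shiftedCoeff_sineWindow_nonneg h ht hρ.le (by rwa [hsq]) hdeath hsum (by rwa [hmul]) hk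

end Johnson

/-! ### Asymptotics of the linear programming bound -/

namespace Typewriter

theorem lp2Fun_pos {a b : ℝ} (hba : b < a) (ha : a ≤ 1 / 2) : 0 < lp2Fun (a, b) :=
  div_pos (by nlinarith) (by positivity)

end Typewriter

namespace Johnson

open Finset Slice Real Filter Topology

/-- The limit of `birthRate n w k / n` as `w / n → a` and `k / n → b`. -/
noncomputable def birthLimit (a b : ℝ) : ℝ :=
  (a - b) * (1 - a - b) * (1 - b) / (1 - 2 * b) ^ 2

/-- The limit of `deathRate n w k / n` as `w / n → a` and `k / n → b`. -/
noncomputable def deathLimit (a b : ℝ) : ℝ :=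
  b * (1 - a - b) * (a - b) / (1 - 2 * b) ^ 2

section Limits

variable {a b : ℝ}

theorem birthLimit_pos (hba : b < a) (ha : a ≤ 1 / 2) : 0 < birthLimit a b :=
  div_pos (mul_pos (mul_pos (by linarith) (by linarith)) (by linarith))
    (pow_pos (by linarith) 2)

theorem deathLimit_pos (hb : 0 < b) (hba : b < a) (ha : a ≤ 1 / 2) : 0 < deathLimit a b :=
  div_pos (mul_pos (mul_pos hb (by linarith)) (by linarith)) (pow_pos (by linarith) 2)

theorem birthLimit_add_deathLimit_sub_two_mul_sqrt (hb : 0 ≤ b) (hba : b < a) (ha : a ≤ 1 / 2) :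
    birthLimit a b + deathLimit a b - 2 * √(birthLimit a b * deathLimit a b) =
      Typewriter.lp2Fun (a, b) / 2 := by
  have h2b : 0 < 1 - 2 * b := by linarith
  have hab : 0 < (a - b) * (1 - a - b) := mul_pos (by linarith) (by linarith)
  have hsq : √(b * (1 - b)) ^ 2 = b * (1 - b) := sq_sqrt (mul_nonneg hb (by linarith))
  have hfactor : (1 - 2 * b) ^ 2 = (1 - 2 * √(b * (1 - b))) * (1 + 2 * √(b * (1 - b))) := by
    linear_combination 4 * hsq
  have hgeom : √(birthLimit a b * deathLimit a b) =
      √(b * (1 - b)) * ((a - b) * (1 - a - b)) / (1 - 2 * b) ^ 2 := by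
    rw [← sqrt_sq (div_nonneg (mul_nonneg (sqrt_nonneg _) hab.le) (sq_nonneg (1 - 2 * b))),
      div_pow, mul_pow, hsq, birthLimit, deathLimit, div_mul_div_comm]
    congr 2 <;> ring
  rw [hgeom, birthLimit, deathLimit, Typewriter.lp2Fun]
  have hplus : 0 < 1 + 2 * √(b * (1 - b)) := by positivity
  have hminus : 0 < 1 - 2 * √(b * (1 - b)) :=
    pos_of_mul_pos_left (hfactor ▸ pow_pos h2b 2) hplus.le
  rw [hfactor]
  field_simp
  ring

variable {w k : ℕ → ℕ}

theorem tendsto_birthRate_div (hb : b < 1 / 2) (hw : Tendsto (fun n => (w n : ℝ) / n) atTop (𝓝 a))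
    (hk : Tendsto (fun n => (k n : ℝ) / n) atTop (𝓝 b)) :
    Tendsto (fun n : ℕ => birthRate n (w n) (k n) / n) atTop (𝓝 (birthLimit a b)) := by
  have hinv : Tendsto (fun n : ℕ => (1 : ℝ) / n) atTop (𝓝 0) :=
    tendsto_one_div_atTop_nhds_zero_nat
  have hden : (1 - 2 * b) * (1 + 0 - 2 * b) ≠ 0 := by
    rw [add_zero, ← sq]
    exact pow_ne_zero 2 (by linarith)
  have hlim := (((hw.sub hk).mul ((hw.const_sub 1).sub hk)).mul ((hinv.const_add 1).sub hk)).div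
    (((hk.const_mul 2).const_sub 1).mul ((hinv.const_add 1).sub (hk.const_mul 2))) hden
  simp only [add_zero, ← sq] at hlim
  refine hlim.congr' ?_
  filter_upwards [eventually_ne_atTop 0] with n hn
  have hn : (n : ℝ) ≠ 0 := Nat.cast_ne_zero.2 hn
  rw [Pi.div_apply, birthRate, div_div, ← mul_div_mul_right _ _ (pow_ne_zero 3 hn)]
  congr 1 <;> field_simp

theorem tendsto_deathRate_div (hb : b < 1 / 2) (hw : Tendsto (fun n => (w n : ℝ) / n) atTop (𝓝 a))
    (hk : Tendsto (fun n => (k n : ℝ) / n) atTop (𝓝 b)) :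
    Tendsto (fun n : ℕ => deathRate n (w n) (k n) / n) atTop (𝓝 (deathLimit a b)) := by
  have hinv : Tendsto (fun n : ℕ => (1 : ℝ) / n) atTop (𝓝 0) :=
    tendsto_one_div_atTop_nhds_zero_nat
  have hden : (1 + 2 * 0 - 2 * b) * (1 + 0 - 2 * b) ≠ 0 := by
    rw [mul_zero, add_zero, ← sq]
    exact pow_ne_zero 2 (by linarith)
  have hlim := ((hk.mul (((hinv.const_add 1).sub hw).sub hk)).mul ((hw.add hinv).sub hk)).div
    ((((hinv.const_mul 2).const_add 1).sub (hk.const_mul 2)).mul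
      ((hinv.const_add 1).sub (hk.const_mul 2))) hden
  simp only [mul_zero, add_zero, ← sq] at hlim
  refine hlim.congr' ?_
  filter_upwards [eventually_ne_atTop 0] with n hn
  have hn : (n : ℝ) ≠ 0 := Nat.cast_ne_zero.2 hn
  rw [Pi.div_apply, deathRate, div_div, ← mul_div_mul_right _ _ (pow_ne_zero 3 hn)]
  congr 1 <;> field_simp

end Limits

theorem exists_window_length {B D T : ℝ} (hB : 0 < B) (hD : 0 < D)
    (hT : B + D - 2 * √(B * D) < T) :
    ∃ L : ℕ, 1 ≤ L ∧ ∃ p q e : ℝ, 0 < p ∧ p < B ∧ 0 < q ∧ q < D ∧ B + D < e ∧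
      e - 2 * √(p * q) * cos (π / (L + 1)) < T := by
  have hcont : Continuous fun x : ℝ =>
      B + D + x - 2 * √((B - x) * (D - x)) * cos (π * x) := by fun_prop
  have hlim := (hcont.tendsto 0).comp (tendsto_one_div_add_atTop_nhds_zero_nat (𝕜 := ℝ))
  have hzero := tendsto_one_div_add_atTop_nhds_zero_nat (𝕜 := ℝ)
  obtain ⟨L, hL, hLB, hLD, hLT⟩ := ((eventually_ge_atTop 1).and
    ((hzero.eventually_lt_const hB).and ((hzero.eventually_lt_const hD).and
      (hlim.eventually_lt_const (by simpa using hT))))).exists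
  have hpos : (0 : ℝ) < 1 / (L + 1) := by positivity
  refine ⟨L, hL, B - 1 / (L + 1), D - 1 / (L + 1), B + D + 1 / (L + 1), sub_pos.2 hLB,
    sub_lt_self B hpos, sub_pos.2 hLD, sub_lt_self D hpos, lt_add_of_pos_right _ hpos, ?_⟩
  rwa [div_eq_mul_one_div π]

theorem tendsto_floor_mul_div {a : ℝ} (ha : 0 ≤ a) :
    Tendsto (fun n : ℕ => (⌊a * n⌋₊ : ℝ) / n) atTop (𝓝 a) :=
  (tendsto_nat_floor_mul_div_atTop ha).comp tendsto_natCast_atTop_atTop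

theorem tendsto_floor_mul_atTop {b : ℝ} (hb : 0 < b) :
    Tendsto (fun n : ℕ => ⌊b * n⌋₊) atTop atTop :=
  tendsto_nat_floor_atTop.comp (tendsto_natCast_atTop_atTop.const_mul_atTop hb)

theorem tendsto_floor_sub_add_div {b : ℝ} (hb : 0 < b) (L i : ℕ) :
    Tendsto (fun n : ℕ => ((⌊b * n⌋₊ - L + i : ℕ) : ℝ) / n) atTop (𝓝 b) := by
  have hlim := (tendsto_floor_mul_div hb.le).add
    (tendsto_const_div_atTop_nhds_zero_nat ((i : ℝ) - L))
  rw [add_zero] at hlim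
  refine hlim.congr' ?_
  filter_upwards [(tendsto_floor_mul_atTop hb).eventually_ge_atTop L] with n hn
  rw [← add_div]
  push_cast [Nat.cast_sub hn]
  ring

theorem eventually_rates_window {a b p q e : ℝ} (hb : 0 < b) (hba : b < a) (ha : a ≤ 1 / 2)
    (hp : p < birthLimit a b) (hq : q < deathLimit a b)
    (he : birthLimit a b + deathLimit a b < e) (L : ℕ) :
    ∀ᶠ n : ℕ in atTop, ∀ k : ℕ, ⌊b * n⌋₊ - L ≤ k → k ≤ ⌊b * n⌋₊ - L + L + 1 →
      n * p ≤ birthRate n ⌊a * n⌋₊ k ∧ n * q ≤ deathRate n ⌊a * n⌋₊ k ∧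
        birthRate n ⌊a * n⌋₊ k + deathRate n ⌊a * n⌋₊ k ≤ n * e := by
  have hw := tendsto_floor_mul_div (hb.trans hba).le
  have hevent (i : ℕ) (_ : i ∈ range (L + 2)) : ∀ᶠ n : ℕ in atTop,
      p < birthRate n ⌊a * n⌋₊ (⌊b * n⌋₊ - L + i : ℕ) / n ∧
      q < deathRate n ⌊a * n⌋₊ (⌊b * n⌋₊ - L + i : ℕ) / n ∧
      birthRate n ⌊a * n⌋₊ (⌊b * n⌋₊ - L + i : ℕ) / n +
        deathRate n ⌊a * n⌋₊ (⌊b * n⌋₊ - L + i : ℕ) / n < e := by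
    have hbirth := tendsto_birthRate_div (by linarith) hw (tendsto_floor_sub_add_div hb L i)
    have hdeath := tendsto_deathRate_div (by linarith) hw (tendsto_floor_sub_add_div hb L i)
    exact (hbirth.eventually_const_lt hp).and ((hdeath.eventually_const_lt hq).and
      ((hbirth.add hdeath).eventually_lt_const he))
  filter_upwards [(eventually_all_finset _).2 hevent, eventually_gt_atTop 0]
    with n hwin hn k hsk hkt
  have hn : (0 : ℝ) < n := by exact_mod_cast hn
  obtain ⟨i, rfl⟩ := Nat.exists_eq_add_of_le hsk
  obtain ⟨hbirth, hdeath, hsum⟩ := hwin i (mem_range.2 (by omega))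
  rw [lt_div_iff₀' hn] at hbirth hdeath
  rw [← add_div, div_lt_iff₀' hn] at hsum
  exact ⟨hbirth.le, hdeath.le, hsum.le⟩

theorem eventually_floor_mul_lt_floor_mul {a b : ℝ} (hb : 0 ≤ b) (hba : b < a) :
    ∀ᶠ n : ℕ in atTop, ⌊b * n⌋₊ < ⌊a * n⌋₊ := by
  have hgap : Tendsto (fun n : ℕ => (a - b) * n) atTop atTop :=
    tendsto_natCast_atTop_atTop.const_mul_atTop (sub_pos.2 hba)
  filter_upwards [hgap.eventually_ge_atTop 1] with n hn
  refine Nat.le_floor ?_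
  have := Nat.floor_le (by positivity : 0 ≤ b * n)
  push_cast
  linarith

theorem two_mul_floor_mul_le {a : ℝ} (ha0 : 0 ≤ a) (ha : a ≤ 1 / 2) (n : ℕ) :
    2 * ⌊a * n⌋₊ ≤ n := by
  have hfloor := Nat.floor_le (by positivity : 0 ≤ a * n)
  have hhalf := mul_le_mul_of_nonneg_right ha n.cast_nonneg
  have : (2 : ℝ) * ⌊a * n⌋₊ ≤ n := by linarith
  exact_mod_cast this

theorem eventually_card_code_le {a b T : ℝ} (hb : 0 < b) (hba : b < a) (ha : a ≤ 1 / 2)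
    (hT : Typewriter.lp2Fun (a, b) / 2 < T) :
    ∀ᶠ n : ℕ in atTop, ∀ C : Finset (Slice n ⌊a * n⌋₊),
      (∀ x ∈ C, ∀ y ∈ C, x ≠ y → n * T + 1 ≤ dist x y) →
      (#C : ℝ) ≤ (n * T + 1) * ∑ k ∈ range (⌊b * n⌋₊ + 1), (n.choose k : ℝ) := by
  have hT0 : 0 ≤ T :=
    (half_pos (Typewriter.lp2Fun_pos hba ha)).le.trans hT.le
  rw [← birthLimit_add_deathLimit_sub_two_mul_sqrt hb.le hba ha] at hT
  obtain ⟨L, hL, p, q, e, hp0, hp, hq0, hq, he, hTL⟩ :=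
    exists_window_length (birthLimit_pos hba ha) (deathLimit_pos hb hba ha) hT
  filter_upwards [eventually_rates_window hb hba ha hp hq he L,
    (tendsto_floor_mul_atTop hb).eventually_ge_atTop L,
    eventually_floor_mul_lt_floor_mul hb.le hba, eventually_gt_atTop 0] with n hwin hLn hlt hn C hC
  have hn : (0 : ℝ) < n := by exact_mod_cast hn
  have hsqrt : √(n * p * (n * q)) = n * √(p * q) := by
    rw [mul_mul_mul_comm, sqrt_mul (mul_self_nonneg _), sqrt_mul_self hn.le]
  have hcard := card_code_le_of_window (two_mul_floor_mul_le (hb.trans hba).le ha n)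
    (s := ⌊b * n⌋₊ - L) (τ := n * T) (d := n * T + 1) hL (by omega) (mul_pos hn hp0)
    (mul_pos hn hq0) (fun k hsk hkt => (hwin k hsk hkt).1) (fun k hsk hkt => (hwin k hsk hkt).2.1)
    (fun k hsk hkt => (hwin k hsk hkt).2.2)
    (by rw [hsqrt]; linarith [mul_le_mul_of_nonneg_left hTL.le hn.le])
    (mul_nonneg hn.le hT0) (by linarith) C hC
  rwa [Nat.sub_add_cancel hLn, add_sub_cancel_left, mul_one] at hcard

end Johnson

/-! ### Entropy bounds for binomial coefficients -/

namespace Johnson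

open Finset Real

section Entropy

variable {n w : ℕ}

theorem exp_mul_log_add {x y : ℝ} (hx : 0 < x) (hy : 0 < y) (k m : ℕ) :
    exp (k * log x + m * log y) = x ^ k * y ^ m := by
  rw [exp_add, exp_nat_mul, exp_nat_mul, exp_log hx, exp_log hy]

theorem exp_neg_mul_binEntropy_le {b : ℝ} (hb0 : 0 < b) (hb : b ≤ 1 / 2) {k : ℕ} (hkn : k ≤ n)
    (hk : (k : ℝ) ≤ b * n) : exp (-(n * binEntropy b)) ≤ b ^ k * (1 - b) ^ (n - k) := by
  rw [← exp_mul_log_add hb0 (by linarith), exp_le_exp, binEntropy, log_inv, log_inv,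
    Nat.cast_sub hkn]
  have hlog : log b ≤ log (1 - b) := log_le_log hb0 (by linarith)
  linarith [mul_le_mul_of_nonneg_right hk (sub_nonneg.2 hlog)]

theorem sum_choose_le_exp {b : ℝ} (hb0 : 0 < b) (hb : b ≤ 1 / 2) {t : ℕ} (ht : (t : ℝ) ≤ b * n) :
    ∑ k ∈ range (t + 1), (n.choose k : ℝ) ≤ exp (n * binEntropy b) := by
  have htn : t ≤ n := by
    have := ht.trans (mul_le_of_le_one_left n.cast_nonneg (by linarith : b ≤ 1))
    exact_mod_cast this
  have hsum : (∑ k ∈ range (t + 1), (n.choose k : ℝ)) * exp (-(n * binEntropy b)) ≤ 1 :=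
    calc (∑ k ∈ range (t + 1), (n.choose k : ℝ)) * exp (-(n * binEntropy b))
      _ ≤ ∑ k ∈ range (t + 1), b ^ k * (1 - b) ^ (n - k) * n.choose k := by
          rw [sum_mul]
          refine sum_le_sum fun k hk => ?_
          have hk := mem_range_succ_iff.1 hk
          rw [mul_comm]
          exact mul_le_mul_of_nonneg_right (exp_neg_mul_binEntropy_le hb0 hb (hk.trans htn)
            (ht.trans' (by exact_mod_cast hk))) (Nat.cast_nonneg _)
      _ ≤ ∑ k ∈ range (n + 1), b ^ k * (1 - b) ^ (n - k) * n.choose k :=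
          sum_le_sum_of_subset_of_nonneg (range_mono (by omega)) fun k _ _ =>
            have : 0 ≤ 1 - b := by linarith
            by positivity
      _ = 1 := by rw [← add_pow, add_sub_cancel, one_pow]
  rwa [exp_neg, ← div_eq_mul_inv, div_le_one (exp_pos _)] at hsum

/-- The unnormalized weight of `k` in the binomial distribution on `n` trials with mean `w`. -/
def binomialWeight (n w k : ℕ) : ℕ :=
  n.choose k * (w ^ k * (n - w) ^ (n - k))

theorem sum_binomialWeight (hw : w ≤ n) : ∑ k ∈ range (n + 1), binomialWeight n w k = n ^ n := by
  calc ∑ k ∈ range (n + 1), binomialWeight n w k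
      = ∑ k ∈ range (n + 1), w ^ k * (n - w) ^ (n - k) * n.choose k :=
        sum_congr rfl fun k _ => mul_comm _ _
    _ = n ^ n := by
        simpa only [Nat.add_sub_cancel' hw, Nat.cast_id] using (add_pow w (n - w) n).symm

theorem binomialWeight_succ_mul {k : ℕ} (hk : k < n) :
    binomialWeight n w (k + 1) * ((k + 1) * (n - w)) =
      binomialWeight n w k * ((n - k) * w) := by
  rw [binomialWeight, binomialWeight, show n - k = n - (k + 1) + 1 by omega, pow_succ, pow_succ]
  have hchoose := Nat.choose_succ_right_eq n k
  rw [show n - k = n - (k + 1) + 1 by omega] at hchoose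
  linear_combination (w ^ (k + 1) * (n - w) ^ (n - (k + 1)) * (n - w)) * hchoose

theorem binomialWeight_le_succ {k : ℕ} (hw : w < n) (hk : k < w) :
    binomialWeight n w k ≤ binomialWeight n w (k + 1) := by
  have hpos : 0 < (n - k) * w := Nat.mul_pos (by omega) (by omega)
  refine Nat.le_of_mul_le_mul_right ?_ hpos
  rw [← binomialWeight_succ_mul (by omega), mul_comm (n - k)]
  exact Nat.mul_le_mul_left _ (Nat.mul_le_mul hk (by omega))

theorem binomialWeight_succ_le {k : ℕ} (hw : w ≤ k) (hk : k < n) :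
    binomialWeight n w (k + 1) ≤ binomialWeight n w k := by
  have hpos : 0 < (k + 1) * (n - w) := Nat.mul_pos (by omega) (by omega)
  refine Nat.le_of_mul_le_mul_right ?_ hpos
  rw [binomialWeight_succ_mul hk, mul_comm (k + 1)]
  exact Nat.mul_le_mul_left _ (Nat.mul_le_mul (by omega) (by omega))

theorem binomialWeight_le_self (hw : w < n) {k : ℕ} (hk : k ≤ n) :
    binomialWeight n w k ≤ binomialWeight n w w := by
  rcases le_total k w with hkw | hkw
  · induction hkw using Nat.decreasingInduction with
    | self => exact le_rfl
    | of_succ k hkw ih => exact (binomialWeight_le_succ hw hkw).trans (ih (by omega))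
  · induction k, hkw using Nat.le_induction with
    | base => exact le_rfl
    | succ k hkw ih => exact (binomialWeight_succ_le hkw hk).trans (ih (by omega))

theorem pow_self_le_mul_binomialWeight (hw : w < n) :
    n ^ n ≤ (n + 1) * binomialWeight n w w := by
  rw [← sum_binomialWeight hw.le]
  refine (sum_le_card_nsmul _ _ _ fun k hk =>
    binomialWeight_le_self hw (mem_range_succ_iff.1 hk)).trans_eq ?_
  rw [card_range, smul_eq_mul]

theorem exp_mul_binEntropy_div (hw0 : 0 < w) (hw : w < n) :
    exp (n * binEntropy (w / n)) * ((w : ℝ) ^ w * ((n : ℝ) - w) ^ (n - w)) = (n : ℝ) ^ n := by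
  have hn : (0 : ℝ) < n := by exact_mod_cast hw0.trans hw
  have hw0 : (0 : ℝ) < w := by exact_mod_cast hw0
  have hnw : (0 : ℝ) < n - w := sub_pos.2 (by exact_mod_cast hw)
  rw [← exp_mul_log_add hw0 hnw, ← exp_log (pow_pos hn n), log_pow, ← exp_add,
    Nat.cast_sub hw.le, exp_eq_exp, binEntropy, one_sub_div hn.ne', inv_div, inv_div,
    log_div hn.ne' hw0.ne', log_div hn.ne' hnw.ne']
  field_simp
  ring

theorem exp_le_choose (hw0 : 0 < w) (hw : w < n) :
    exp (n * binEntropy (w / n)) ≤ (n + 1) * n.choose w := by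
  have hnw : (0 : ℝ) < n - w := sub_pos.2 (by exact_mod_cast hw)
  have hpow : (n : ℝ) ^ n ≤ (n + 1) * (n.choose w * ((w : ℝ) ^ w * ((n : ℝ) - w) ^ (n - w))) := by
    rw [← Nat.cast_sub hw.le]
    exact_mod_cast pow_self_le_mul_binomialWeight hw
  rw [← exp_mul_binEntropy_div hw0 hw, ← mul_assoc (n + 1 : ℝ)] at hpow
  exact le_of_mul_le_mul_right hpow (by positivity)

end Entropy

end Johnson

/-! ### The typewriter channel -/

namespace Typewriter

open Finset Johnson Johnson.Slice

section Channel

variable {q : ℕ} {ε : ℝ}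

theorem natCast_ne_zero_of_lt {m : ℕ} (hm : 0 < m) (hmq : m < q) : (m : ZMod q) ≠ 0 := by
  rw [Ne, ZMod.natCast_eq_zero_iff]
  exact fun h => hmq.not_ge (Nat.le_of_dvd hm h)

theorem add_one_ne (hq : 3 ≤ q) (x : ZMod q) : x + 1 ≠ x := by
  simpa using natCast_ne_zero_of_lt (q := q) one_pos (by omega)

theorem add_one_add_one_ne (hq : 3 ≤ q) (x : ZMod q) : x + 1 + 1 ≠ x := by
  have htwo := natCast_ne_zero_of_lt (q := q) two_pos hq
  rw [add_assoc, one_add_one_eq_two]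
  simpa using htwo

theorem W_nonneg (h0 : 0 ≤ ε) (h1 : ε ≤ 1) (x y : ZMod q) : 0 ≤ W q ε x y := by
  unfold W
  split_ifs <;> linarith

theorem Wn_nonneg (h0 : 0 ≤ ε) (h1 : ε ≤ 1) {n : ℕ} (x y : Fin n → ZMod q) : 0 ≤ Wn q ε x y :=
  prod_nonneg fun _ _ => W_nonneg h0 h1 _ _

theorem W_self (x : ZMod q) : W q ε x x = 1 - ε :=
  if_pos rfl

theorem W_add_one (hq : 3 ≤ q) (x : ZMod q) : W q ε x (x + 1) = ε := by
  rw [W, if_neg (add_one_ne hq x), if_pos rfl]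

theorem eq_or_eq_of_W_ne_zero {x y : ZMod q} (h : W q ε x y ≠ 0) : y = x ∨ y = x + 1 := by
  contrapose! h
  rw [W, if_neg h.1, if_neg h.2]

theorem eq_add_one_of_W_ne_zero (hq : 3 ≤ q) {x y : ZMod q} (h : W q ε x y ≠ 0)
    (h' : W q ε (x + 1) y ≠ 0) : y = x + 1 := by
  rcases eq_or_eq_of_W_ne_zero h with rfl | h
  · rcases eq_or_eq_of_W_ne_zero h' with h | h
    · exact absurd h.symm (add_one_ne hq y)
    · exact absurd h.symm (add_one_add_one_ne hq y)
  · exact h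

theorem sum_sqrt_W_self [NeZero q] (hq : 3 ≤ q) (h0 : 0 ≤ ε) (h1 : ε ≤ 1) (x : ZMod q) :
    ∑ y, √(W q ε x y * W q ε x y) = 1 := by
  simp only [Real.sqrt_mul_self (W_nonneg h0 h1 x _)]
  rw [sum_eq_add x (x + 1) (add_one_ne hq x).symm
    (fun y _ hy => by rw [W, if_neg hy.1, if_neg hy.2]) (by simp) (by simp), W_self, W_add_one hq,
    sub_add_cancel]

theorem sum_sqrt_W_add_one [NeZero q] (hq : 3 ≤ q) (x : ZMod q) :
    ∑ y, √(W q ε x y * W q ε (x + 1) y) = alphaEps ε := by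
  rw [sum_eq_single (x + 1) (fun y _ hy => ?_) (by simp), W_add_one hq, W_self, alphaEps]
  have hzero : W q ε x y * W q ε (x + 1) y = 0 := by
    contrapose! hy
    exact eq_add_one_of_W_ne_zero hq (left_ne_zero_of_mul hy) (right_ne_zero_of_mul hy)
  rw [hzero, Real.sqrt_zero]

end Channel

section Slice

variable {q n w : ℕ} {ε : ℝ}

/-- The word over `ℤ/qℤ` that is `1` on the `w`-subset `z` and `0` elsewhere. -/
def word (q : ℕ) {n w : ℕ} (z : Slice n w) (i : Fin n) : ZMod q :=
  if i ∈ z.1 then 1 else 0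

theorem word_injective (hq : 3 ≤ q) : Function.Injective (word q : Slice n w → Fin n → ZMod q) := by
  intro z z' hzz'
  have hone : (1 : ZMod q) ≠ 0 := by simpa using add_one_ne hq 0
  ext i
  have hi := congrFun hzz' i
  by_cases hz : i ∈ z.1 <;> by_cases hz' : i ∈ z'.1 <;> simp_all [word]

theorem W_mul_eq (hq : 3 ≤ q) (a : ZMod q) (z z' : Slice n w) (i : Fin n) (y : ZMod q)
    (h : W q ε (a + word q z i) y ≠ 0) (h' : W q ε (a + word q z' i) y ≠ 0) :
    W q ε (a + word q z i) y * ((if i ∈ z.1 then ε else 1) * (if i ∈ z'.1 then 1 - ε else 1)) =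
      W q ε (a + word q z' i) y *
        ((if i ∈ z'.1 then ε else 1) * (if i ∈ z.1 then 1 - ε else 1)) := by
  by_cases hz : i ∈ z.1 <;> by_cases hz' : i ∈ z'.1 <;>
    simp only [word, hz, hz', if_true, if_false, add_zero] at h h' ⊢
  · rw [eq_add_one_of_W_ne_zero hq h' h, W_self, W_add_one hq]
    ring
  · rw [eq_add_one_of_W_ne_zero hq h h', W_self, W_add_one hq]
    ring

theorem prod_ite_mem_slice (z : Slice n w) (c : ℝ) : ∏ i, (if i ∈ z.1 then c else 1) = c ^ w := by
  rw [prod_ite_mem, univ_inter, prod_const, z.2]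

/- Over all coordinates the factors on either side of `W_mul_eq` multiply to `ε ^ w * (1 - ε) ^ w`,
since the two words have the same weight. -/
theorem Wn_eq_of_ne_zero (hq : 3 ≤ q) (h0 : 0 < ε) (h1 : ε < 1) (a y : Fin n → ZMod q)
    (z z' : Slice n w) (h : Wn q ε (a + word q z) y ≠ 0) (h' : Wn q ε (a + word q z') y ≠ 0) :
    Wn q ε (a + word q z) y = Wn q ε (a + word q z') y := by
  refine mul_right_cancel₀ (mul_pos (pow_pos h0 w) (pow_pos (sub_pos.2 h1) w)).ne' ?_
  conv_lhs => rw [← prod_ite_mem_slice z ε, ← prod_ite_mem_slice z' (1 - ε)]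
  conv_rhs => rw [← prod_ite_mem_slice z' ε, ← prod_ite_mem_slice z (1 - ε)]
  simp only [Wn, ← prod_mul_distrib]
  exact prod_congr rfl fun i _ => W_mul_eq hq (a i) z z' i (y i)
    (prod_ne_zero_iff.1 h i (mem_univ i)) (prod_ne_zero_iff.1 h' i (mem_univ i))

theorem prod_sqrt_le_min (hq : 3 ≤ q) (h0 : 0 < ε) (h1 : ε < 1) (a y : Fin n → ZMod q)
    (z z' : Slice n w) :
    ∏ i, √(W q ε ((a + word q z) i) (y i) * W q ε ((a + word q z') i) (y i)) ≤
      min (Wn q ε (a + word q z) y) (Wn q ε (a + word q z') y) := by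
  have hV := Wn_nonneg h0.le h1.le (a + word q z) y
  have hV' := Wn_nonneg h0.le h1.le (a + word q z') y
  have hprod : ∏ i, √(W q ε ((a + word q z) i) (y i) * W q ε ((a + word q z') i) (y i)) =
      √(Wn q ε (a + word q z) y * Wn q ε (a + word q z') y) := by
    rw [Wn, Wn, ← prod_mul_distrib, Real.sqrt_prod _ fun i _ =>
      mul_nonneg (W_nonneg h0.le h1.le _ _) (W_nonneg h0.le h1.le _ _)]
  rw [hprod]
  by_cases hz : Wn q ε (a + word q z) y * Wn q ε (a + word q z') y = 0
  · rw [hz, Real.sqrt_zero]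
    exact le_min hV hV'
  · rw [← Wn_eq_of_ne_zero hq h0 h1 a y z z' (left_ne_zero_of_mul hz) (right_ne_zero_of_mul hz),
      Real.sqrt_mul_self hV, min_self]

theorem pow_le_sum_min [NeZero q] (hq : 3 ≤ q) (h0 : 0 < ε) (h1 : ε < 1)
    (a : Fin n → ZMod q) (z z' : Slice n w) :
    alphaEps ε ^ (2 * dist z z') ≤
      ∑ y, min (Wn q ε (a + word q z) y) (Wn q ε (a + word q z') y) := by
  have hsum (i : Fin n) :
      ∑ y, √(W q ε ((a + word q z) i) y * W q ε ((a + word q z') i) y) =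
        (if i ∈ z.1 \ z'.1 then alphaEps ε else 1) *
          (if i ∈ z'.1 \ z.1 then alphaEps ε else 1) := by
    by_cases hz : i ∈ z.1 <;> by_cases hz' : i ∈ z'.1 <;>
      simp only [Pi.add_apply, word, hz, hz', mem_sdiff, if_true, if_false, add_zero, not_true,
        not_false_iff, and_true, and_false, mul_one, one_mul]
    · exact sum_sqrt_W_self hq h0.le h1.le _
    · simp only [fun y => mul_comm (W q ε (a i + 1) y), sum_sqrt_W_add_one hq]
    · exact sum_sqrt_W_add_one hq _
    · exact sum_sqrt_W_self hq h0.le h1.le _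
  calc alphaEps ε ^ (2 * dist z z') = alphaEps ε ^ dist z z' * alphaEps ε ^ dist z' z := by
        rw [two_mul, pow_add, dist_comm z' z]
    _ = ∏ i, ∑ y, √(W q ε ((a + word q z) i) y * W q ε ((a + word q z') i) y) := by
        simp only [hsum, prod_mul_distrib, prod_ite_mem, univ_inter, prod_const]
        rfl
    _ = ∑ y : Fin n → ZMod q,
          ∏ i, √(W q ε ((a + word q z) i) (y i) * W q ε ((a + word q z') i) (y i)) := by
        rw [prod_univ_sum, Fintype.piFinset_univ]
    _ ≤ ∑ y, min (Wn q ε (a + word q z) y) (Wn q ε (a + word q z') y) :=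
        sum_le_sum fun y _ => prod_sqrt_le_min hq h0 h1 a y z z'

/- The Elias–Bassalygo argument: on average a translate of the words of weight `w` contains
`#T * n.choose w / q ^ n` of the codewords. -/
theorem exists_translate_dist_lt [NeZero q] (hq : 3 ≤ q) {ι : Type*} (c : ι → Fin n → ZMod q)
    (T : Finset ι) {d K : ℝ} (hd : 0 < d)
    (hK : ∀ C : Finset (Slice n w), (∀ x ∈ C, ∀ y ∈ C, x ≠ y → d ≤ dist x y) → (#C : ℝ) ≤ K)
    (hlt : (q : ℝ) ^ n * K < #T * n.choose w) :
    ∃ m ∈ T, ∃ m' ∈ T, m ≠ m' ∧ ∃ (a : Fin n → ZMod q) (z z' : Slice n w),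
      c m = a + word q z ∧ c m' = a + word q z' ∧ (dist z z' : ℝ) < d := by
  classical
  have hpigeon : #(univ : Finset (Fin n → ZMod q)) • K <
      (#(T ×ˢ (univ : Finset (Slice n w))) : ℝ) := by
    rw [card_product, card_univ, card_univ, Fintype.card_finset_len, Fintype.card_fin,
      Fintype.card_fun, ZMod.card, Fintype.card_fin, nsmul_eq_mul]
    exact_mod_cast hlt
  obtain ⟨a, -, ha⟩ := exists_lt_card_fiber_of_nsmul_lt_card_of_maps_to
    (f := fun p : ι × Slice n w => c p.1 - word q p.2) (fun p _ => mem_univ _) hpigeon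
  set F := (T ×ˢ (univ : Finset (Slice n w))).filter fun p => c p.1 - word q p.2 = a
  have hF (p) (hp : p ∈ F) : p.1 ∈ T ∧ c p.1 = a + word q p.2 := by
    simp only [F, mem_filter, mem_product] at hp
    exact ⟨hp.1.1, sub_eq_iff_eq_add.1 hp.2⟩
  by_contra! hfar
  replace hfar (p) (hp : p ∈ F) (p') (hp' : p' ∈ F) (hne : p.1 ≠ p'.1) : d ≤ dist p.2 p'.2 :=
    hfar p.1 (hF p hp).1 p'.1 (hF p' hp').1 hne a p.2 p'.2 (hF p hp).2 (hF p' hp').2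
  have hinj : Set.InjOn Prod.snd (F : Set (ι × Slice n w)) := fun p hp p' hp' hsnd => by
    refine Prod.ext ?_ hsnd
    by_contra hne
    have := hfar p hp p' hp' hne
    rw [hsnd, dist_self, Nat.cast_zero] at this
    exact hd.not_ge this
  refine ha.not_ge ?_
  rw [← card_image_of_injOn hinj]
  refine hK _ fun x hx y hy hxy => ?_
  obtain ⟨p, hp, rfl⟩ := mem_image.1 hx
  obtain ⟨p', hp', rfl⟩ := mem_image.1 hy
  refine hfar p hp p' hp' fun hfst => hxy (word_injective hq (add_left_cancel (a := a) ?_))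
  rw [← (hF p hp).2, ← (hF p' hp').2, hfst]

end Slice

section ErrorProbability

theorem card_le_two_mul_card_filter {ι : Type*} [Fintype ι] {f : ι → ℝ} (hf : ∀ i, 0 ≤ f i) :
    (Fintype.card ι : ℝ) ≤ 2 * #{i | Fintype.card ι * f i ≤ 2 * ∑ j, f j} := by
  classical
  set S : Finset ι := {i | ¬ Fintype.card ι * f i ≤ 2 * ∑ j, f j}
  have hsplit : (#{i | Fintype.card ι * f i ≤ 2 * ∑ j, f j} : ℝ) + #S = Fintype.card ι := by
    exact_mod_cast card_filter_add_card_filter_not (s := univ)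
      (fun i => (Fintype.card ι : ℝ) * f i ≤ 2 * ∑ j, f j)
  have hS : 2 * (#S : ℝ) ≤ Fintype.card ι := by
    rcases S.eq_empty_or_nonempty with hS | hS
    · simp [hS]
    refine le_of_lt (lt_of_mul_lt_mul_right ?_ (sum_nonneg fun i _ => hf i : 0 ≤ ∑ i, f i))
    calc 2 * (#S : ℝ) * ∑ i, f i = ∑ i ∈ S, 2 * ∑ j, f j := by
          rw [sum_const, nsmul_eq_mul]
          ring
      _ < ∑ i ∈ S, Fintype.card ι * f i :=
          sum_lt_sum_of_nonempty hS fun i hi => not_le.1 (mem_filter.1 hi).2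
      _ ≤ Fintype.card ι * ∑ i, f i := by
          rw [← mul_sum]
          exact mul_le_mul_of_nonneg_left (sum_le_univ_sum_of_nonneg hf) (Nat.cast_nonneg _)
  linarith

variable {q n w M : ℕ} [NeZero q] {ε : ℝ}

/-- The probability of error when the message `m` is sent; `avgError` is its average. -/
noncomputable def msgError (q : ℕ) [NeZero q] (ε : ℝ) {M n : ℕ} (c : Fin M → Fin n → ZMod q)
    (dec : (Fin n → ZMod q) → Fin M) (m : Fin M) : ℝ :=
  ∑ y, if dec y = m then 0 else Wn q ε (c m) y

theorem msgError_nonneg (h0 : 0 ≤ ε) (h1 : ε ≤ 1) (c : Fin M → Fin n → ZMod q)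
    (dec : (Fin n → ZMod q) → Fin M) (m : Fin M) : 0 ≤ msgError q ε c dec m :=
  sum_nonneg fun y _ => by
    split_ifs
    · exact le_rfl
    · exact Wn_nonneg h0 h1 _ _

theorem sum_min_le_msgError_add (h0 : 0 ≤ ε) (h1 : ε ≤ 1) (c : Fin M → Fin n → ZMod q)
    (dec : (Fin n → ZMod q) → Fin M) {m m' : Fin M} (hm : m ≠ m') :
    ∑ y, min (Wn q ε (c m) y) (Wn q ε (c m') y) ≤
      msgError q ε c dec m + msgError q ε c dec m' := by
  rw [msgError, msgError, ← sum_add_distrib]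
  refine sum_le_sum fun y _ => ?_
  by_cases hy : dec y = m
  · rw [if_pos hy, if_neg (fun h => hm (hy.symm.trans h)), zero_add]
    exact min_le_right _ _
  · rw [if_neg hy]
    refine (min_le_left _ _).trans (le_add_of_nonneg_right ?_)
    split_ifs
    · exact le_rfl
    · exact Wn_nonneg h0 h1 _ _

theorem le_two_mul_card_msgError_le (h0 : 0 ≤ ε) (h1 : ε ≤ 1) (hM : 1 ≤ M)
    (c : Fin M → Fin n → ZMod q) (dec : (Fin n → ZMod q) → Fin M) :
    (M : ℝ) ≤ 2 * #{m | msgError q ε c dec m ≤ 2 * avgError q ε c dec} := by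
  have hM : (0 : ℝ) < M := by exact_mod_cast hM
  have havg : avgError q ε c dec = (∑ m, msgError q ε c dec m) / M := one_div_mul_eq_div _ _
  simp only [havg, mul_div_assoc', le_div_iff₀' hM]
  simpa only [Fintype.card_fin] using
    card_le_two_mul_card_filter fun m => msgError_nonneg h0 h1 c dec m

theorem exists_pow_le_avgError (hq : 3 ≤ q) (h0 : 0 < ε) (h1 : ε < 1)
    (hM : 1 ≤ M) (c : Fin M → Fin n → ZMod q) (dec : (Fin n → ZMod q) → Fin M) {d K : ℝ}
    (hd : 0 < d)
    (hK : ∀ C : Finset (Slice n w), (∀ x ∈ C, ∀ y ∈ C, x ≠ y → d ≤ dist x y) → (#C : ℝ) ≤ K)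
    (hlt : 2 * ((q : ℝ) ^ n * K) < M * n.choose w) :
    ∃ j : ℕ, (j : ℝ) < d ∧ alphaEps ε ^ (2 * j) ≤ 4 * avgError q ε c dec := by
  have hT := le_two_mul_card_msgError_le h0.le h1.le hM c dec
  obtain ⟨m, hm, m', hm', hne, a, z, z', hz, hz', hdist⟩ := exists_translate_dist_lt hq c
    {m | msgError q ε c dec m ≤ 2 * avgError q ε c dec} hd hK
    (by linarith [mul_le_mul_of_nonneg_right hT (n.choose w).cast_nonneg])
  refine ⟨dist z z', hdist, ?_⟩
  have hmin := sum_min_le_msgError_add h0.le h1.le c dec hne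
  rw [hz, hz'] at hmin
  linarith [pow_le_sum_min hq h0 h1 a z z', (mem_filter.1 hm).2, (mem_filter.1 hm').2]

end ErrorProbability

end Typewriter

/-! ### The reliability function -/

namespace Typewriter

open Filter Topology

section Optimization

theorem continuous_h2 : Continuous h2 :=
  Real.binEntropy_continuous.div_const _

theorem strictMonoOn_h2 : StrictMonoOn h2 (Set.Icc 0 (1 / 2)) := by
  intro x hx y hy hxy
  rw [one_div] at hx hy
  exact div_lt_div_of_pos_right (Real.binEntropy_strictMonoOn hx hy hxy)
    (Real.log_pos one_lt_two)

theorem h2_zero : h2 0 = 0 := by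
  rw [h2, Real.binEntropy_zero, zero_div]

theorem h2_one_half : h2 (1 / 2) = 1 := by
  rw [h2, one_div, Real.binEntropy_two_inv, div_self (Real.log_pos one_lt_two).ne']

theorem continuous_lp2Fun : Continuous lp2Fun := by
  unfold lp2Fun
  exact Continuous.div (by fun_prop) (by fun_prop) fun p => by positivity

/- Moving from a point of the region towards `(1 / 2, 0)` makes the rate constraint strict. -/
theorem one_sub_h2_add_h2_lt {a b r t : ℝ} (hr : 0 < r) (hab : (a, b) ∈ lp2Region r) (ht : 0 < t)
    (ht1 : t < 1) : 1 - h2 (a + t * (1 / 2 - a)) + h2 ((1 - t) * b) < r := by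
  obtain ⟨hb, hba, ha, hreg⟩ := hab
  simp only at hb hba ha hreg
  have hamem : a ∈ Set.Icc (0 : ℝ) (1 / 2) := ⟨by linarith, ha⟩
  have hbmem : b ∈ Set.Icc (0 : ℝ) (1 / 2) := ⟨hb, by linarith⟩
  have hamem' : a + t * (1 / 2 - a) ∈ Set.Icc (0 : ℝ) (1 / 2) := ⟨by nlinarith, by nlinarith⟩
  have hbmem' : (1 - t) * b ∈ Set.Icc (0 : ℝ) (1 / 2) := ⟨by nlinarith, by nlinarith⟩
  have hale : h2 a ≤ h2 (a + t * (1 / 2 - a)) :=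
    strictMonoOn_h2.monotoneOn hamem hamem' (by nlinarith)
  have hble : h2 ((1 - t) * b) ≤ h2 b := strictMonoOn_h2.monotoneOn hbmem' hbmem (by nlinarith)
  rcases ha.lt_or_eq with halt | rfl
  · linarith [strictMonoOn_h2 hamem hamem' (by nlinarith)]
  rcases hb.lt_or_eq with hblt | rfl
  · linarith [strictMonoOn_h2 hbmem' hbmem (by nlinarith)]
  · rw [mul_zero, sub_self, mul_zero, add_zero, h2_zero, h2_one_half]
    linarith

theorem exists_lp2Fun_lt_of_mem {a b r B : ℝ} (hr : 0 < r) (hab : (a, b) ∈ lp2Region r)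
    (hB : lp2Fun (a, b) < B) :
    ∃ a' b', 0 ≤ b' ∧ b' < a' ∧ a' ≤ 1 / 2 ∧ 1 - h2 a' + h2 b' < r ∧ lp2Fun (a', b') < B := by
  have hcont : Continuous fun t : ℝ => lp2Fun (a + t * (1 / 2 - a), (1 - t) * b) :=
    continuous_lp2Fun.comp (by fun_prop)
  have hlp : ∀ᶠ t in 𝓝[>] (0 : ℝ), lp2Fun (a + t * (1 / 2 - a), (1 - t) * b) < B :=
    nhdsWithin_le_nhds ((hcont.tendsto 0).eventually_lt_const (by simpa using hB))
  have hmem : ∀ᶠ t in 𝓝[>] (0 : ℝ), t ∈ Set.Ioo 0 1 := Ioo_mem_nhdsGT one_pos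
  obtain ⟨t, htB, ht0, ht1⟩ := (hlp.and hmem).exists
  have hstrict := one_sub_h2_add_h2_lt hr hab ht0 ht1
  obtain ⟨hb, hba, ha, -⟩ := hab
  simp only at hb hba ha
  exact ⟨_, _, mul_nonneg (by linarith) hb, by nlinarith, by nlinarith, hstrict, htB⟩

theorem exists_lp2Fun_lt {r B : ℝ} (hr : 0 < r) (hB : deltaLP2 r < B) :
    ∃ a b, 0 < b ∧ b < a ∧ a ≤ 1 / 2 ∧ 1 - h2 a + h2 b < r ∧ lp2Fun (a, b) < B := by
  obtain ⟨⟨⟨a₀, b₀⟩, hmem, hval⟩, -⟩ := isLeast_deltaLP2 r hr.le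
  obtain ⟨a, b₁, hb₁, hba₁, ha, hreg₁, hB₁⟩ := exists_lp2Fun_lt_of_mem hr hmem (hval.trans_lt hB)
  have hlp : ∀ᶠ b in 𝓝[>] b₁, lp2Fun (a, b) < B :=
    have hcont : Continuous fun b : ℝ => lp2Fun (a, b) := continuous_lp2Fun.comp (by fun_prop)
    nhdsWithin_le_nhds ((hcont.tendsto b₁).eventually_lt_const hB₁)
  have hreg : ∀ᶠ b in 𝓝[>] b₁, 1 - h2 a + h2 b < r :=
    nhdsWithin_le_nhds (((continuous_h2.const_add _).tendsto b₁).eventually_lt_const hreg₁)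
  have hmem : ∀ᶠ b in 𝓝[>] b₁, b ∈ Set.Ioo b₁ a := Ioo_mem_nhdsGT hba₁
  obtain ⟨b, hB, hr, hb, hba⟩ := (hlp.and (hreg.and hmem)).exists
  exact ⟨a, b, hb₁.trans_lt hb, hba, ha, hr, hB⟩

end Optimization

section Rate

theorem eventually_quadratic_lt_exp {γ : ℝ} (hγ : 0 < γ) (T : ℝ) :
    ∀ᶠ n : ℕ in atTop, 2 * ((n + 1) * (n * T + 1)) < Real.exp (n * γ) := by
  have hlim (k : ℕ) : Tendsto (fun n : ℕ => (n : ℝ) ^ k * Real.exp (-γ) ^ n) atTop (𝓝 0) :=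
    tendsto_pow_const_mul_const_pow_of_abs_lt_one k
      (by rwa [Real.abs_exp, Real.exp_lt_one_iff, neg_lt_zero])
  have hsum := ((hlim 2).const_mul (2 * T)).add
    (((hlim 1).const_mul (2 * (T + 1))).add ((hlim 0).const_mul 2))
  simp only [mul_zero, add_zero] at hsum
  filter_upwards [hsum.eventually_lt_const one_pos] with n hn
  rw [← one_mul (Real.exp _), ← div_lt_iff₀ (Real.exp_pos _), div_eq_mul_inv, ← Real.exp_neg,
    ← mul_neg, Real.exp_nat_mul]
  exact hn.trans_eq' (by ring)

theorem eventually_exp_le_choose {a s : ℝ} (ha0 : 0 < a) (ha1 : a < 1)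
    (hs : s < Real.binEntropy a) :
    ∀ᶠ n : ℕ in atTop, Real.exp (n * s) ≤ (n + 1) * n.choose ⌊a * n⌋₊ := by
  have hentropy := (Real.binEntropy_continuous.tendsto a).comp
    (Johnson.tendsto_floor_mul_div ha0.le)
  filter_upwards [hentropy.eventually_const_lt hs,
    (Johnson.tendsto_floor_mul_atTop ha0).eventually_gt_atTop 0,
    eventually_gt_atTop 0] with n hsn hfloor hn
  have hn : (0 : ℝ) < n := by exact_mod_cast hn
  have hlt : ⌊a * n⌋₊ < n := (Nat.floor_lt (by positivity)).2 (by nlinarith)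
  exact (Real.exp_le_exp.2 (mul_le_mul_of_nonneg_left hsn.le hn.le)).trans
    (Johnson.exp_le_choose hfloor hlt)

theorem rate_gap_pos {q a b R : ℝ} (hq : 0 < q)
    (hR : 1 - h2 a + h2 b < R - Real.logb 2 (q / 2)) :
    0 < R * Real.log 2 + Real.binEntropy a - Real.binEntropy b - Real.log q := by
  have hlog : 0 < Real.log 2 := Real.log_pos one_lt_two
  rw [Real.logb, Real.log_div hq.ne' two_ne_zero, h2, h2] at hR
  have := mul_pos (sub_pos.2 hR) hlog
  field_simp at this
  linarith

theorem eventually_lt_card {q a b R T : ℝ} (hq : 0 < q) (hb : 0 < b) (hba : b < a)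
    (ha : a ≤ 1 / 2) (hR : 1 - h2 a + h2 b < R - Real.logb 2 (q / 2)) (hT : 0 ≤ T) :
    ∀ᶠ n : ℕ in atTop,
      2 * (q ^ n * ((n * T + 1) * ∑ k ∈ Finset.range (⌊b * n⌋₊ + 1), (n.choose k : ℝ))) <
        ⌈(2 : ℝ) ^ (n * R)⌉₊ * n.choose ⌊a * n⌋₊ := by
  obtain ⟨γ, hγ⟩ : ∃ γ, γ = R * Real.log 2 + Real.binEntropy a - Real.binEntropy b - Real.log q :=
    ⟨_, rfl⟩
  have hγ0 : 0 < γ := hγ ▸ rate_gap_pos hq hR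
  filter_upwards [eventually_quadratic_lt_exp (half_pos hγ0) T,
    eventually_exp_le_choose (hb.trans hba) (by linarith) (sub_lt_self _ (half_pos hγ0))]
    with n hquad hchoose
  have hball := Johnson.sum_choose_le_exp (n := n) hb (by linarith) (Nat.floor_le (by positivity))
  have hpow : q ^ n = Real.exp (n * Real.log q) := by rw [Real.exp_nat_mul, Real.exp_log hq]
  have hcard : Real.exp (n * (R * Real.log 2)) ≤ ⌈(2 : ℝ) ^ (n * R)⌉₊ := by
    refine (Nat.le_ceil _).trans' ?_
    rw [Real.rpow_def_of_pos two_pos, mul_comm (Real.log 2), mul_assoc]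
  refine lt_of_mul_lt_mul_left ?_ (by positivity : (0 : ℝ) ≤ n + 1)
  calc (n + 1) *
        (2 * (q ^ n * ((n * T + 1) * ∑ k ∈ Finset.range (⌊b * n⌋₊ + 1), (n.choose k : ℝ))))
    _ = 2 * ((n + 1) * (n * T + 1)) * Real.exp (n * Real.log q) *
        ∑ k ∈ Finset.range (⌊b * n⌋₊ + 1), (n.choose k : ℝ) := by rw [hpow]; ring
    _ ≤ 2 * ((n + 1) * (n * T + 1)) * Real.exp (n * Real.log q) *
        Real.exp (n * Real.binEntropy b) := by gcongr
    _ < Real.exp (n * (γ / 2)) * Real.exp (n * Real.log q) * Real.exp (n * Real.binEntropy b) := by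
        gcongr
    _ = Real.exp (n * (R * Real.log 2)) * Real.exp (n * (Real.binEntropy a - γ / 2)) := by
        simp only [← Real.exp_add]
        congr 1
        rw [hγ]
        ring
    _ ≤ ⌈(2 : ℝ) ^ (n * R)⌉₊ * ((n + 1) * n.choose ⌊a * n⌋₊) := by gcongr
    _ = (n + 1) * (⌈(2 : ℝ) ^ (n * R)⌉₊ * n.choose ⌊a * n⌋₊) := by ring

end Rate

section Reliability

theorem alphaEps_pos {ε : ℝ} (h0 : 0 < ε) (h1 : ε < 1) : 0 < alphaEps ε :=
  Real.sqrt_pos.2 (mul_pos h0 (sub_pos.2 h1))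

theorem alphaEps_le_one (ε : ℝ) : alphaEps ε ≤ 1 :=
  Real.sqrt_le_one.2 (by nlinarith [sq_nonneg (ε - 1)])

theorem logb_one_div_le {α P : ℝ} {j : ℕ} (hα : 0 < α) (hP : α ^ (2 * j) ≤ 4 * P) :
    Real.logb 2 (1 / P) ≤ 2 + 2 * j * Real.logb 2 (1 / α) := by
  have hpow : 0 < α ^ (2 * j) := pow_pos hα _
  have hP0 : 0 < P := by linarith
  have h4 : Real.logb 2 4 = 2 := by
    rw [show (4 : ℝ) = 2 ^ (2 : ℝ) by norm_num, Real.logb_rpow two_pos (by norm_num)]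
  calc Real.logb 2 (1 / P)
    _ ≤ Real.logb 2 (4 / α ^ (2 * j)) :=
        Real.logb_le_logb_of_le one_lt_two (by positivity)
          ((div_le_div_iff₀ hP0 hpow).2 (by rwa [one_mul]))
    _ = 2 + 2 * j * Real.logb 2 (1 / α) := by
        rw [Real.logb_div four_ne_zero hpow.ne', Real.logb_pow, one_div, Real.logb_inv, h4]
        push_cast
        ring

theorem exponent_le {α P T : ℝ} {j n : ℕ} (hα0 : 0 < α) (hα1 : α ≤ 1) (hn : 0 < n)
    (hj : j ≤ n * T + 1) (hP : α ^ (2 * j) ≤ 4 * P) :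
    exponent P n ≤ ((2 * T * Real.logb 2 (1 / α) + (2 + 2 * Real.logb 2 (1 / α)) / n : ℝ) :
      EReal) := by
  have hP0 : 0 < P := by linarith [pow_pos hα0 (2 * j)]
  have hn : (0 : ℝ) < n := by exact_mod_cast hn
  have hlog : 0 ≤ Real.logb 2 (1 / α) := Real.logb_nonneg one_lt_two (one_le_one_div hα0 hα1)
  rw [exponent, if_neg hP0.ne', EReal.coe_le_coe_iff, one_div_mul_eq_div, div_le_iff₀ hn, add_mul,
    div_mul_cancel₀ _ hn.ne']
  linarith [logb_one_div_le hα0 hP, mul_le_mul_of_nonneg_right hj hlog]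

variable {q : ℕ} [NeZero q] {ε R B : ℝ}

theorem eventually_exponent_minError_le (hq : 3 ≤ q) (h0 : 0 < ε) (h1 : ε < 1)
    (hR : Real.logb 2 ((q : ℝ) / 2) < R) (hB : deltaLP2 (R - Real.logb 2 ((q : ℝ) / 2)) < B) :
    ∀ᶠ n : ℕ in atTop, exponent (minError q ε ⌈(2 : ℝ) ^ ((n : ℝ) * R)⌉₊ n) n ≤
      ((B * Real.logb 2 (1 / alphaEps ε) + (2 + 2 * Real.logb 2 (1 / alphaEps ε)) / n : ℝ) :
        EReal) := by
  obtain ⟨a, b, hb, hba, ha, hreg, hlt⟩ := exists_lp2Fun_lt (sub_pos.2 hR) hB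
  have hB0 : 0 < B := (lp2Fun_pos hba ha).trans hlt
  filter_upwards [Johnson.eventually_card_code_le hb hba ha (div_lt_div_of_pos_right hlt two_pos),
    eventually_lt_card (by positivity) hb hba ha hreg (half_pos hB0).le, eventually_gt_atTop 0]
    with n hcode hcard hn
  have hM : 1 ≤ ⌈(2 : ℝ) ^ ((n : ℝ) * R)⌉₊ := Nat.one_le_ceil_iff.2 (by positivity)
  obtain ⟨c, dec, hmin⟩ := exists_avgError_eq_minError q ε _ n hM
  obtain ⟨j, hj, hpow⟩ :=
    exists_pow_le_avgError hq h0 h1 hM c dec (by positivity) hcode hcard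
  rw [hmin] at hpow
  have hexp := exponent_le (alphaEps_pos h0 h1) (alphaEps_le_one ε) hn hj.le hpow
  rwa [mul_div_cancel₀ B two_ne_zero] at hexp

theorem reliability_le_of_deltaLP2_lt (hq : 3 ≤ q) (h0 : 0 < ε) (h1 : ε < 1)
    (hR : Real.logb 2 ((q : ℝ) / 2) < R) (hB : deltaLP2 (R - Real.logb 2 ((q : ℝ) / 2)) < B) :
    reliability q ε R ≤ ((B * Real.logb 2 (1 / alphaEps ε) : ℝ) : EReal) := by
  have hlim := (tendsto_const_div_atTop_nhds_zero_nat
    (2 + 2 * Real.logb 2 (1 / alphaEps ε))).const_add (B * Real.logb 2 (1 / alphaEps ε))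
  rw [add_zero] at hlim
  exact (limsup_le_limsup (eventually_exponent_minError_le hq h0 h1 hR hB)).trans_eq
    (EReal.tendsto_coe.2 hlim).limsup_eq

end Reliability

end Typewriter

open Filter Topology in
theorem theorem4_general (q : ℕ) [NeZero q] (hq : 3 ≤ q) (ε : ℝ) (hε0 : 0 < ε) (hε1 : ε < 1)
    (R : ℝ) (hR : Real.logb 2 ((q : ℝ) / 2) < R) :
    Typewriter.reliability q ε R ≤
      ((Typewriter.deltaLP2 (R - Real.logb 2 ((q : ℝ) / 2)) *
        Real.logb 2 (1 / Typewriter.alphaEps ε) : ℝ) : EReal) := by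
  obtain ⟨δ, hδ⟩ : ∃ δ, δ = Typewriter.deltaLP2 (R - Real.logb 2 ((q : ℝ) / 2)) := ⟨_, rfl⟩
  rw [← hδ]
  have hlim : Tendsto (fun B : ℝ => ((B * Real.logb 2 (1 / Typewriter.alphaEps ε) : ℝ) : EReal))
      (𝓝[>] δ) (𝓝 ((δ * Real.logb 2 (1 / Typewriter.alphaEps ε) : ℝ) : EReal)) :=
    EReal.tendsto_coe.2 ((tendsto_id.mul_const _).mono_left nhdsWithin_le_nhds)
  refine ge_of_tendsto hlim ?_
  filter_upwards [self_mem_nhdsWithin] with B hB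
  exact Typewriter.reliability_le_of_deltaLP2_lt hq hε0 hε1 hR (hδ ▸ hB)

theorem theorem4 (q : ℕ) [NeZero q] (hq : 4 ≤ q) (ε : ℝ) (hε0 : 0 < ε) (hε1 : ε ≤ 1 / 2)
    (R : ℝ) (hR : Real.logb 2 ((q : ℝ) / 2) < R) :
    Typewriter.reliability q ε R ≤
      ((Typewriter.deltaLP2 (R - Real.logb 2 ((q : ℝ) / 2)) *
        Real.logb 2 (1 / Typewriter.alphaEps ε) : ℝ) : EReal) :=
  theorem4_general q (Nat.le_of_succ_le hq) ε hε0 (by linarith) R hR
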